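/- Let $\mathbb N=\{1,2,\dots\}$ and $[n]=\{1,\dots,n\}$. An \emph{indexed forest} is a sequence $F=(T_1,T_2,\dots)$ of binary plane trees (every node is either a leaf or an internal node with a left child $v_L$ and a right child $v_R$), all but finitely many of which are the one-node tree $\ast$. Its leaves are identified with $\mathbb N$ from left to right. Write $\emptyset$ for the forest with all trees trivial, $\operatorname{supp}(F)$ for the set of leaves of the nontrivial trees, and $\mathsf{Forest}_n=\{F : \operatorname{supp}(F)\subseteq[n]\}$. The \emph{canonical label} of an internal node $v$ is the rightmost leaf that is a descendant of (or equal to) $v_L$. A \emph{Sylvester word} of $F$ is a sequence that contains the canonical label of each internal node of $F$ exactly once, and nothing else, such that the label of each internal node precedes the labels of those of its children that are internal; $\operatorname{Sylv}(F)$ is the set of these words. Let $\operatorname{QDes}(F)$ be the set of leaves $i$ such that $i=v_L$ for a terminal node $v$ of $F$ (an internal node both of whose children are leaves), and for $i\in\operatorname{QDes}(F)$ let $F/i$ be the indexed forest obtained by deleting this terminal node, i.e. by replacing it with a leaf. For $f(\mathbf x;\mathbf t)\in\mathbb Z[\mathbf t][\mathbf x]$, where $\mathbf x=(x_1,x_2,\dots)$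 and $\mathbf t=(t_1,t_2,\dots)$, put $$\mathsf E_i f=\frac{f(x_1,\dots,x_{i-1},x_i,t_i,x_{i+1},\dots;\mathbf t)-f(x_1,\dots,x_{i-1},t_i,x_i,x_{i+1},\dots;\mathbf t)}{x_i-t_i}.$$ The \emph{double forest polynomials} $\mathfrak P_F(\mathbf x;\mathbf t)$ are the unique family of homogeneous polynomials in $\mathbb Z[\mathbf t][\mathbf x]$, indexed by all indexed forests $F$, such that $\mathfrak P_\emptyset(\mathbf t;\mathbf t)=1$, $\mathfrak P_F(\mathbf t;\mathbf t)=0$ for $F\neq\emptyset$, and, for all $i\ge1$, $\mathsf E_i\mathfrak P_F=\mathfrak P_{F/i}(\mathbf x;t_1,\dots,t_{i-1},t_{i+1},\dots)$ if $i\in\operatorname{QDes}(F)$ and $\mathsf E_i\mathfrak P_F=0$ otherwise. For a permutation $\sigma$ of $\mathbb N$ moving only finitely many elements, let $\operatorname{ev}_\sigma f=f(t_{\sigma(1)},t_{\sigma(2)},\dots;\mathbf t)\in\mathbb Z[\mathbf t]$. Regard $S_n$ as the group of permutations of $\mathbb N$ that fix every $a>n$, let $s_i=(i\;i+1)$, and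 let $\ell(\sigma)$ be the number of inversions of $\sigma\in S_n$. A set partition of $[n]$ is noncrossing if there are no two distinct blocks $A,B$ with $a,b\in A$, $c,d\in B$ and $a<c<b<d$. Let $\operatorname{NC}_n\subseteq S_n$ be the set of \emph{noncrossing permutations}: products, over the blocks $\{a_1<\dots<a_p\}$ of a noncrossing partition of $[n]$, of the cycles $(a_p\,a_{p-1}\cdots a_1)$. A \emph{noncrossing descent} of $\sigma\in\operatorname{NC}_n$ is an $i$ with $1\le i<n$, $\sigma s_i\in\operatorname{NC}_n$ and $\ell(\sigma s_i)<\ell(\sigma)$. A \emph{noncrossing reduced word} of $\sigma\in\operatorname{NC}_n$ is a word $(i_1,\dots,i_\ell)$ with $s_{i_1}\cdots s_{i_\ell}=\sigma$ such that for every $1\le k\le\ell$ the permutation $s_{i_1}\cdots s_{i_k}$ lies in $\operatorname{NC}_n$ and has $i_k$ as a noncrossing descent. \textbf{Theorem.} Let $F\in\mathsf{Forest}_n$, let $\sigma\in\operatorname{NC}_n$, let $\omega=(i_1,\dots,i_\ell)$ be any noncrossing reduced word of $\sigma$, and put $\sigma^{(p)}=s_{i_1}\cdots s_{i_p}$. Then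 $$\operatorname{ev}_\sigma(\mathfrak P_F)=\sum_{S}\ \prod_{p\in S}\bigl(t_{\sigma^{(p-1)}(i_p+1)}-t_{\sigma^{(p-1)}(i_p)}\bigr),$$ where the sum is over all sets of positions $S=\{p_1<\dots<p_m\}\subseteq\{1,\dots,\ell\}$ such that the subword $(i_{p_1},\dots,i_{p_m})$ of $\omega$ is a Sylvester word of $F$. -/

import Mathlib

/-!
All indices are shifted down by one: the positive integer `i` of the mathematical text is the
natural number `i - 1` here.  Thus the variables are `x 0, x 1, …` and `t 0, t 1, …`, leaves and
trees of a forest are numbered from `0`, `[n]` is `{0, …, n - 1}` and the simple transposition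
`s i` exchanges `i` and `i + 1` for `i = 0, 1, …`.
-/

/-! ### Indexed forests -/

/-- A binary plane tree is a `BinaryTree Unit`, where `nil` is the tree with one node (a leaf) and
`node () l r` has an internal root with left subtree `l` and right subtree `r`.  An indexed forest
is a sequence of such trees, all but finitely many of which are trivial. -/
@[ext]
structure IndexedForest where
  trees : ℕ → BinaryTree Unit
  finite_nontrivial : {k | trees k ≠ BinaryTree.nil}.Finite

/-- `SubtreeAt t a s b`: if the leaves of `t` are numbered `a, a + 1, …` from left to right, then
the subtree of descendants of some node of `t` is `s`, with its leaves numbered `b, b + 1, …`. -/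
inductive SubtreeAt (t : BinaryTree Unit) (a : ℕ) : BinaryTree Unit → ℕ → Prop
  | root : SubtreeAt t a t a
  | left {l r : BinaryTree Unit} {b : ℕ} :
      SubtreeAt t a (BinaryTree.node () l r) b → SubtreeAt t a l b
  | right {l r : BinaryTree Unit} {b : ℕ} :
      SubtreeAt t a (BinaryTree.node () l r) b → SubtreeAt t a r (b + l.numLeaves)

/-- Delete the terminal node whose left leaf has position `i` in the tree (the leaves of the tree
being numbered `0, 1, …`); the tree is unchanged if there is no such node. -/
def trimTree : ℕ → BinaryTree Unit → BinaryTree Unit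
  | _, BinaryTree.nil => BinaryTree.nil
  | i, BinaryTree.node _ BinaryTree.nil BinaryTree.nil =>
      if i = 0 then BinaryTree.nil else BinaryTree.node () BinaryTree.nil BinaryTree.nil
  | i, BinaryTree.node _ l r =>
      if i < l.numLeaves then BinaryTree.node () (trimTree i l) r
      else BinaryTree.node () l (trimTree (i - l.numLeaves) r)

namespace IndexedForest

/-- The forest all of whose trees are trivial. -/
def empty : IndexedForest where
  trees _ := BinaryTree.nil
  finite_nontrivial := by simp

/-- The number of the leftmost leaf of the `k`-th tree. -/
def firstLeaf (F : IndexedForest) (k : ℕ) : ℕ :=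
  ∑ j ∈ Finset.range k, (F.trees j).numLeaves

/-- A node of the forest whose subtree of descendants is `s` with leftmost leaf `b`. -/
def HasSubtree (F : IndexedForest) (s : BinaryTree Unit) (b : ℕ) : Prop :=
  ∃ k, SubtreeAt (F.trees k) (F.firstLeaf k) s b

/-- The leaves of the nontrivial trees. -/
def support (F : IndexedForest) : Set ℕ :=
  {j | ∃ k, F.trees k ≠ BinaryTree.nil ∧ F.firstLeaf k ≤ j ∧
    j < F.firstLeaf k + (F.trees k).numLeaves}

/-- The leftmost leaves of the terminal nodes (those whose two children are leaves). -/
def qdes (F : IndexedForest) : Set ℕ :=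
  {i | F.HasSubtree (BinaryTree.node () BinaryTree.nil BinaryTree.nil) i}

/-- `F / i`: for `i ∈ F.qdes`, delete the terminal node with leftmost leaf `i`. -/
def trim (F : IndexedForest) (i : ℕ) : IndexedForest where
  trees k := if F.firstLeaf k ≤ i ∧ i < F.firstLeaf (k + 1)
    then trimTree (i - F.firstLeaf k) (F.trees k) else F.trees k
  finite_nontrivial := by
    refine F.finite_nontrivial.subset fun k hk h => hk ?_
    simp [h, trimTree]

/-- The canonical label of an internal node with subtrees `l`, `r` and leftmost leaf `b`: the
rightmost leaf of the left subtree. -/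
def nodeLabel (l : BinaryTree Unit) (b : ℕ) : ℕ := b + l.numLeaves - 1

/-- Sylvester words: every canonical label of an internal node occurs exactly once, nothing else
occurs, and the label of an internal node precedes the labels of its internal children. -/
structure IsSylvester (F : IndexedForest) (w : List ℕ) : Prop where
  nodup : w.Nodup
  mem_iff : ∀ i, i ∈ w ↔ ∃ l r b, F.HasSubtree (BinaryTree.node () l r) b ∧ i = nodeLabel l b
  before_left : ∀ l₁ l₂ r b, F.HasSubtree (BinaryTree.node () (BinaryTree.node () l₁ l₂) r) b →
    w.idxOf (nodeLabel (BinaryTree.node () l₁ l₂) b) < w.idxOf (nodeLabel l₁ b)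
  before_right : ∀ l r₁ r₂ b, F.HasSubtree (BinaryTree.node () l (BinaryTree.node () r₁ r₂)) b →
    w.idxOf (nodeLabel l b) < w.idxOf (nodeLabel r₁ (b + l.numLeaves))

end IndexedForest

/-! ### Double forest polynomials -/

noncomputable section

/-- The ring `ℤ[t][x]`. -/
abbrev PolTX : Type := MvPolynomial (ℕ ⊕ ℕ) ℤ

/-- The ring `ℤ[t]`. -/
abbrev PolT : Type := MvPolynomial ℕ ℤ

def xVar (i : ℕ) : PolTX := MvPolynomial.X (Sum.inl i)

def tVar (i : ℕ) : PolTX := MvPolynomial.X (Sum.inr i)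

/-- `f ↦ f(x_0, …, x_{i-1}, t_i, x_i, x_{i+1}, …; t)`. -/
def bsMinus (i : ℕ) : PolTX →ₐ[ℤ] PolTX :=
  MvPolynomial.aeval (Sum.elim
    (fun j => if j < i then xVar j else if j = i then tVar i else xVar (j - 1)) tVar)

/-- `f ↦ f(x_0, …, x_{i-1}, x_i, t_i, x_{i+1}, …; t)`. -/
def bsPlus (i : ℕ) : PolTX →ₐ[ℤ] PolTX :=
  MvPolynomial.aeval (Sum.elim
    (fun j => if j ≤ i then xVar j else if j = i + 1 then tVar i else xVar (j - 1)) tVar)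

theorem dvd_bsPlus_sub_bsMinus (i : ℕ) (f : PolTX) :
    xVar i - tVar i ∣ bsPlus i f - bsMinus i f := by
  induction f using MvPolynomial.induction_on with
  | C a => simp [bsPlus, bsMinus]
  | add p q hp hq =>
    have h : bsPlus i (p + q) - bsMinus i (p + q)
        = (bsPlus i p - bsMinus i p) + (bsPlus i q - bsMinus i q) := by
      simp only [map_add]; ring
    rw [h]
    exact dvd_add hp hq
  | mul_X p v hp =>
    have hv : xVar i - tVar i ∣
        bsPlus i (MvPolynomial.X v) - bsMinus i (MvPolynomial.X v) := by
      rcases v with j | j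
      · simp only [bsPlus, bsMinus, MvPolynomial.aeval_X, Sum.elim_inl]
        rcases lt_trichotomy j i with h | h | h
        · simp [h, h.le]
        · subst h; simp
        · rcases eq_or_ne j (i + 1) with h' | h'
          · subst h'
            simpa using (dvd_sub_comm).mp (dvd_refl (xVar i - tVar i))
          · simp [h.not_ge, h.not_gt, h.ne', h']
      · simp [bsPlus, bsMinus]
    have h : bsPlus i (p * MvPolynomial.X v) - bsMinus i (p * MvPolynomial.X v)
        = bsPlus i p * (bsPlus i (MvPolynomial.X v) - bsMinus i (MvPolynomial.X v))
          + (bsPlus i p - bsMinus i p) * bsMinus i (MvPolynomial.X v) := by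
      simp only [map_mul]; ring
    rw [h]
    exact dvd_add (dvd_mul_of_dvd_right hv _) (dvd_mul_of_dvd_left hp _)

/-- The equivariant trimming operation, the quotient of `bsPlus i f - bsMinus i f` by
`x i - t i`. -/
def eqTrim (i : ℕ) (f : PolTX) : PolTX := (dvd_bsPlus_sub_bsMinus i f).choose

theorem mul_eqTrim (i : ℕ) (f : PolTX) :
    (xVar i - tVar i) * eqTrim i f = bsPlus i f - bsMinus i f :=
  (dvd_bsPlus_sub_bsMinus i f).choose_spec.symm

/-- `f(x; t) ↦ f(x; t_0, …, t_{i-1}, t_{i+1}, …)`. -/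
def omitT (i : ℕ) : PolTX →ₐ[ℤ] PolTX :=
  MvPolynomial.rename (Sum.map id fun j => if j < i then j else j + 1)

/-- `f(x; t) ↦ f(t_{σ(0)}, t_{σ(1)}, …; t)`. -/
def evPerm (σ : Equiv.Perm ℕ) : PolTX →ₐ[ℤ] PolT :=
  MvPolynomial.aeval (Sum.elim (fun i => MvPolynomial.X (σ i)) MvPolynomial.X)

open Classical in
/-- The properties that single out the family of double forest polynomials. -/
structure IsDoubleForestFamily (P : IndexedForest → PolTX) : Prop where
  homogeneous : ∀ F, ∃ d, (P F).IsHomogeneous d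
  normalized : ∀ F, evPerm 1 (P F) = if F = IndexedForest.empty then 1 else 0
  trimming : ∀ F i, eqTrim i (P F) = if i ∈ F.qdes then omitT i (P (F.trim i)) else 0

/-- The double forest polynomials: the (unique) family with these properties. -/
def doubleForestPoly : IndexedForest → PolTX := Classical.epsilon IsDoubleForestFamily

end

/-! ### Noncrossing permutations and their reduced words -/

/-- The long backwards cycle `(a_p ⋯ a_1)` on a block `{a_p > ⋯ > a_1}`: it maps each `a_k` to
`a_{k-1}`, and `a_1` to `a_p`. -/
def backwardCycle (B : Finset ℕ) : Equiv.Perm ℕ := (B.sort (· ≥ ·)).formPerm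

/-- A set partition of `{0, …, n - 1}` without crossing blocks. -/
def IsNoncrossingPartition {n : ℕ} (P : Finpartition (Finset.range n)) : Prop :=
  ∀ A ∈ P.parts, ∀ B ∈ P.parts, A ≠ B →
    ∀ a ∈ A, ∀ b ∈ A, ∀ c ∈ B, ∀ d ∈ B, ¬ (a < c ∧ c < b ∧ b < d)

/-- `σ ∈ NC_n`, where `S_n` is the group of permutations of `ℕ` that fix every `a ≥ n`: the
permutation `σ` is the product of the backwards cycles on the blocks of a noncrossing partition. -/
def IsNoncrossingPerm (n : ℕ) (σ : Equiv.Perm ℕ) : Prop :=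
  (∀ a, n ≤ a → σ a = a) ∧
    ∃ P : Finpartition (Finset.range n), IsNoncrossingPartition P ∧
      ∀ B ∈ P.parts, ∀ a ∈ B, σ a = backwardCycle B a

/-- The Coxeter length of `σ ∈ S_n`, the number of its inversions. -/
def permLength (n : ℕ) (σ : Equiv.Perm ℕ) : ℕ :=
  ((Finset.range n ×ˢ Finset.range n).filter fun p => p.1 < p.2 ∧ σ p.2 < σ p.1).card

/-- The simple transposition exchanging `i` and `i + 1`. -/
def simpleTransposition (i : ℕ) : Equiv.Perm ℕ := Equiv.swap i (i + 1)

/-- The product `s_{i_1} ⋯ s_{i_ℓ}` of a word `(i_1, …, i_ℓ)`. -/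
def wordPerm (ω : List ℕ) : Equiv.Perm ℕ := (ω.map simpleTransposition).prod

/-- `i` is a noncrossing descent of `σ ∈ NC_n`. -/
def IsNoncrossingDescent (n : ℕ) (σ : Equiv.Perm ℕ) (i : ℕ) : Prop :=
  i + 1 < n ∧ IsNoncrossingPerm n (σ * simpleTransposition i) ∧
    permLength n (σ * simpleTransposition i) < permLength n σ

/-- `ω` is a noncrossing reduced word for `σ`. -/
def IsNoncrossingReducedWord (n : ℕ) (σ : Equiv.Perm ℕ) (ω : List ℕ) : Prop :=
  wordPerm ω = σ ∧ ∀ k : Fin ω.length,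
    IsNoncrossingPerm n (wordPerm (ω.take (k + 1))) ∧
      IsNoncrossingDescent n (wordPerm (ω.take (k + 1))) (ω.get k)

/-! ### Subwords -/

/-- The subword of `ω` on a set of positions. -/
def subwordAt (ω : List ℕ) (S : Finset (Fin ω.length)) : List ℕ :=
  (S.sort (· ≤ ·)).map ω.get

open Classical in
/-- The subwords of `ω`, as sets of positions, that are Sylvester words of `F`. -/
noncomputable def sylvesterSubwords (ω : List ℕ) (F : IndexedForest) :
    Finset (Finset (Fin ω.length)) :=
  Finset.univ.filter fun S => F.IsSylvester (subwordAt ω S)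

/-- The product over the positions `p` of a subword of `t_{τ(i_p + 1)} - t_{τ(i_p)}`, where `τ` is
the product of the simple transpositions of the letters of `ω` before position `p`. -/
noncomputable def subwordWeight (ω : List ℕ) (S : Finset (Fin ω.length)) : PolT :=
  ∏ p ∈ S, (MvPolynomial.X (wordPerm (ω.take p) (ω.get p + 1))
    - MvPolynomial.X (wordPerm (ω.take p) (ω.get p)))

/-! Append one letter `i` to a word with product `σ`. If `σ` takes the value `i` at position `i` or
`i + 1`, then `ev_σ` and `ev_{σ s_i}` are one and the same evaluation applied to the two insertions
of `t_i` whose difference defines `E_i`. Hence `ev_{σ s_i} f - ev_σ f` is `t_{σ(i+1)} - t_{σ(i)}`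
times an evaluation of `E_i f` (`IsDeletion.evPerm_mul`). The formula is an induction on the length
of the word: `ev_σ` accounts for the subwords that avoid the last position, the other term for those
that use it.

For the second term, `E_i P_F` vanishes unless `i ∈ F.qdes`, which is also the condition for a
Sylvester word of `F` to end in `i`; in that case such words correspond to the Sylvester words of `F
/ i` (`isSylvester_append_singleton_iff`). It remains to evaluate `P_{F/i}` at the permutation `τ`
left after deleting the value `i` from `σ`. The value `i` never leaves the positions `i`, `i + 1` in
any prefix of the word, so `τ` is the product of the word with the letters `i` deleted and the
larger ones lowered, and the weights agree after renaming (`IsAdmissibleWord.exists_isDeletion`).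

Of the noncrossing condition only one consequence is used: each step has `σ(i) = i` or `σ(i+1) = i`,
together with an inequality (`IsAdmissibleStep`). Otherwise `σ` or `σ s_i` would have crossing
blocks.

The defining properties alone force the formula, so of the double forest polynomials only existence
is needed. Forests are encoded by multisets, on which trimming is simple arithmetic. Polynomials are
then built by recursion on the degree: prescribed trimmings that satisfy the commutation relations
of the operators come from a common polynomial (`exists_trimAt_eq`), and subtracting its value at `x
= t` normalizes it. -/

open MvPolynomial

/-! ### Insertion and trimming operators on `ℤ[t][x]` -/

/-- The increasing map `ℕ → ℕ` whose range omits exactly `i`. -/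
def skip (i j : ℕ) : ℕ := if j < i then j else j + 1

theorem skip_injective (i : ℕ) : Function.Injective (skip i) := by
  intro a b h
  unfold skip at h
  split_ifs at h <;> omega

theorem skip_ne (i j : ℕ) : skip i j ≠ i := by
  unfold skip
  split_ifs <;> omega

theorem exists_skip_eq {i j : ℕ} (h : j ≠ i) : ∃ k, skip i k = j := by
  rcases lt_or_gt_of_ne h with h | h
  · exact ⟨j, if_pos h⟩
  · exact ⟨j - 1, by rw [skip, if_neg (by omega)]; omega⟩

noncomputable section

/-- `f ↦ f(x_0, …, x_{p-1}, t_a, x_p, …; t)`. -/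
def insertT (p a : ℕ) : PolTX →ₐ[ℤ] PolTX :=
  aeval (Sum.elim (fun j => if j < p then xVar j else if j = p then tVar a else xVar (j - 1)) tVar)

/-- Set `x_m = x_{m+1} = ⋯ = 0`. -/
def truncX (m : ℕ) : PolTX →ₐ[ℤ] PolTX :=
  aeval (Sum.elim (fun j => if j < m then xVar j else 0) tVar)

theorem insertT_xVar (p a j : ℕ) : insertT p a (xVar j) =
    if j < p then xVar j else if j = p then tVar a else xVar (j - 1) := by
  simp [insertT, xVar]

@[simp]
theorem insertT_tVar (p a j : ℕ) : insertT p a (tVar j) = tVar j := by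
  simp [insertT, tVar]

theorem truncX_xVar (m j : ℕ) : truncX m (xVar j) = if j < m then xVar j else 0 := by
  simp [truncX, xVar]

@[simp]
theorem truncX_tVar (m j : ℕ) : truncX m (tVar j) = tVar j := by
  simp [truncX, tVar]

@[simp]
theorem omitT_xVar (i j : ℕ) : omitT i (xVar j) = xVar j := by
  simp [omitT, xVar]

theorem omitT_tVar (i j : ℕ) : omitT i (tVar j) = tVar (skip i j) := by
  simp [omitT, tVar, skip]

theorem polTX_hom_ext {A : Type*} [CommSemiring A] [Algebra ℤ A] {φ ψ : PolTX →ₐ[ℤ] A}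
    (hx : ∀ j, φ (xVar j) = ψ (xVar j)) (ht : ∀ j, φ (tVar j) = ψ (tVar j)) (f : PolTX) :
    φ f = ψ f := by
  have : φ = ψ := by
    ext v
    rcases v with j | j
    · exact hx j
    · exact ht j
  rw [this]

theorem polTX_comp_ext {φ₁ φ₂ ψ₁ ψ₂ : PolTX →ₐ[ℤ] PolTX}
    (hx : ∀ j, φ₁ (φ₂ (xVar j)) = ψ₁ (ψ₂ (xVar j)))
    (ht : ∀ j, φ₁ (φ₂ (tVar j)) = ψ₁ (ψ₂ (tVar j))) (f : PolTX) :
    φ₁ (φ₂ f) = ψ₁ (ψ₂ f) := by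
  have := polTX_hom_ext (φ := φ₁.comp φ₂) (ψ := ψ₁.comp ψ₂) (by simpa using hx)
    (by simpa using ht) f
  simpa only [AlgHom.comp_apply] using this

theorem bsMinus_eq_insertT (i : ℕ) (f : PolTX) : bsMinus i f = insertT i i f := rfl

theorem bsPlus_eq_insertT (i : ℕ) (f : PolTX) : bsPlus i f = insertT (i + 1) i f := by
  refine polTX_hom_ext (fun j => ?_) (fun j => ?_) f
  · rw [insertT_xVar]
    simp [bsPlus, xVar]
  · simp [bsPlus, tVar, insertT]

theorem insertT_insertT {p q : ℕ} (h : p ≤ q) (a b : ℕ) (f : PolTX) :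
    insertT q b (insertT p a f) = insertT p a (insertT (q + 1) b f) := by
  refine polTX_comp_ext (fun j => ?_) (fun j => by simp) f
  simp only [insertT_xVar]
  split_ifs <;> simp only [insertT_xVar, insertT_tVar] <;> (try split_ifs) <;>
    first | rfl | omega

theorem truncX_insertT {p m : ℕ} (h : p ≤ m) (a : ℕ) (f : PolTX) :
    truncX m (insertT p a f) = insertT p a (truncX (m + 1) f) := by
  refine polTX_comp_ext (fun j => ?_) (fun j => by simp) f
  simp only [insertT_xVar, truncX_xVar]
  split_ifs <;> simp only [insertT_xVar, truncX_xVar, truncX_tVar, map_zero] <;> (try split_ifs) <;>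
    first | rfl | omega

theorem insertT_truncX {p m : ℕ} (h : m ≤ p) (a : ℕ) (f : PolTX) :
    insertT p a (truncX m f) = truncX m f := by
  refine polTX_hom_ext (φ := (insertT p a).comp (truncX m))
    (ψ := truncX m) (fun j => ?_) (fun j => by simp) f
  simp only [AlgHom.comp_apply, truncX_xVar]
  split_ifs
  · rw [insertT_xVar, if_pos (by omega)]
  · simp

theorem truncX_truncX {k m : ℕ} (h : k ≤ m) (f : PolTX) : truncX m (truncX k f) = truncX k f := by
  refine polTX_hom_ext (φ := (truncX m).comp (truncX k))
    (ψ := truncX k) (fun j => ?_) (fun j => by simp) f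
  simp only [AlgHom.comp_apply, truncX_xVar]
  split_ifs
  · rw [truncX_xVar, if_pos (by omega)]
  · simp

theorem truncX_omitT (m i : ℕ) (f : PolTX) : truncX m (omitT i f) = omitT i (truncX m f) := by
  refine polTX_comp_ext (fun j => ?_) (fun j => by simp [omitT_tVar]) f
  simp only [truncX_xVar, omitT_xVar]
  split_ifs <;> simp

theorem insertT_omitT (p a i : ℕ) (f : PolTX) :
    insertT p (skip i a) (omitT i f) = omitT i (insertT p a f) := by
  refine polTX_comp_ext (fun j => ?_) (fun j => by simp [omitT_tVar]) f
  simp only [insertT_xVar, omitT_xVar]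
  split_ifs <;> simp [omitT_tVar]

theorem omitT_omitT {i j : ℕ} (h : i ≤ j) (f : PolTX) :
    omitT i (omitT j f) = omitT (j + 1) (omitT i f) := by
  refine polTX_comp_ext (fun k => by simp) (fun k => ?_) f
  simp only [omitT_tVar, skip]
  congr 1
  split_ifs <;> omega

theorem xVar_sub_tVar_ne_zero (i a : ℕ) : xVar i - tVar a ≠ 0 := by
  rw [sub_ne_zero]
  intro h
  simpa using X_injective h

theorem dvd_insertT_sub_insertT (i a : ℕ) (f : PolTX) :
    xVar i - tVar a ∣ insertT (i + 1) a f - insertT i a f := by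
  induction f using MvPolynomial.induction_on with
  | C c => simp [insertT]
  | add p q hp hq =>
    rw [map_add, map_add, add_sub_add_comm]
    exact dvd_add hp hq
  | mul_X p v hp =>
    have hv : xVar i - tVar a ∣ insertT (i + 1) a (X v) - insertT i a (X v) := by
      rcases v with j | j
      · have := insertT_xVar (i + 1) a j
        have h2 := insertT_xVar i a j
        unfold xVar at this h2
        rw [this, h2]
        split_ifs with h₁ h₂ h₃ h₄ h₅ h₆ <;> try omega
        · simp
        · subst h₃; rfl
        · subst h₄
          rw [dvd_sub_comm, add_tsub_cancel_right]
          exact dvd_rfl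
        · simp
      · have := insertT_tVar (i + 1) a j
        have h2 := insertT_tVar i a j
        unfold tVar at this h2
        rw [this, h2]
        simp
    have h : insertT (i + 1) a (p * X v) - insertT i a (p * X v)
        = insertT (i + 1) a p * (insertT (i + 1) a (X v) - insertT i a (X v))
          + (insertT (i + 1) a p - insertT i a p) * insertT i a (X v) := by
      simp only [map_mul]; ring
    rw [h]
    exact dvd_add (dvd_mul_of_dvd_right hv _) (dvd_mul_of_dvd_left hp _)

/-- The trimming operator at position `i` with parameter `t_a`. -/
def trimAt (i a : ℕ) (f : PolTX) : PolTX := (dvd_insertT_sub_insertT i a f).choose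

theorem mul_trimAt (i a : ℕ) (f : PolTX) :
    (xVar i - tVar a) * trimAt i a f = insertT (i + 1) a f - insertT i a f :=
  (dvd_insertT_sub_insertT i a f).choose_spec.symm

theorem trimAt_eq_of_mul {i a : ℕ} {f g : PolTX}
    (h : (xVar i - tVar a) * g = insertT (i + 1) a f - insertT i a f) : trimAt i a f = g :=
  mul_left_cancel₀ (xVar_sub_tVar_ne_zero i a) ((mul_trimAt i a f).trans h.symm)

theorem eqTrim_eq_trimAt (i : ℕ) (f : PolTX) : eqTrim i f = trimAt i i f :=
  (trimAt_eq_of_mul (by rw [mul_eqTrim, bsPlus_eq_insertT, bsMinus_eq_insertT])).symm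

theorem trimAt_add (i a : ℕ) (f g : PolTX) :
    trimAt i a (f + g) = trimAt i a f + trimAt i a g :=
  trimAt_eq_of_mul (by simp only [mul_add, mul_trimAt, map_add]; ring)

theorem trimAt_sub (i a : ℕ) (f g : PolTX) :
    trimAt i a (f - g) = trimAt i a f - trimAt i a g :=
  trimAt_eq_of_mul (by simp only [mul_sub, mul_trimAt, map_sub]; ring)

theorem trimAt_zero (i a : ℕ) : trimAt i a 0 = 0 :=
  trimAt_eq_of_mul (by simp)

/-- This is why position and parameter of a trimming are kept separate: once `t_i` has been omitted,
the parameter is renumbered but the position is not. -/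
theorem trimAt_omitT (j a i : ℕ) (f : PolTX) :
    trimAt j (skip i a) (omitT i f) = omitT i (trimAt j a f) := by
  refine trimAt_eq_of_mul ?_
  rw [insertT_omitT, insertT_omitT, ← map_sub, ← mul_trimAt, map_mul, map_sub, omitT_xVar,
    omitT_tVar]

theorem insertT_xVar_of_lt {p a j : ℕ} (h : j < p) : insertT p a (xVar j) = xVar j := by
  rw [insertT_xVar, if_pos h]

theorem insertT_xVar_succ_of_le {p a j : ℕ} (h : p ≤ j) :
    insertT p a (xVar (j + 1)) = xVar j := by
  rw [insertT_xVar, if_neg (by omega), if_neg (by omega), Nat.add_sub_cancel]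

/-- After multiplication by both linear forms, each side is the same alternating sum of four double
insertions. The larger position shifts by one because the other insertion lies to its left. -/
theorem trimAt_trimAt {i j : ℕ} (h : i < j) (a b : ℕ) (f : PolTX) :
    trimAt j b (trimAt i a f) = trimAt i a (trimAt (j + 1) b f) := by
  refine trimAt_eq_of_mul (mul_left_cancel₀ (xVar_sub_tVar_ne_zero i a) ?_)
  rw [mul_left_comm, mul_trimAt, mul_sub, mul_sub]
  have e₁ : ∀ q, i < q → (xVar i - tVar a) * insertT q b (trimAt i a f) =
      insertT q b (insertT (i + 1) a f) - insertT q b (insertT i a f) := fun q hq => by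
    rw [← map_sub, ← mul_trimAt, map_mul, map_sub, insertT_xVar_of_lt hq, insertT_tVar]
  have e₂ : ∀ p, p ≤ j → (xVar j - tVar b) * insertT p a (trimAt (j + 1) b f) =
      insertT p a (insertT (j + 1 + 1) b f) - insertT p a (insertT (j + 1) b f) := fun p hp => by
    rw [← map_sub, ← mul_trimAt, map_mul, map_sub, insertT_xVar_succ_of_le hp, insertT_tVar]
  rw [e₁ _ h, e₁ _ (by omega), e₂ _ (by omega), e₂ _ (by omega),
    insertT_insertT (by omega : i + 1 ≤ j + 1), insertT_insertT (by omega : i + 1 ≤ j),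
    insertT_insertT (by omega : i ≤ j + 1), insertT_insertT (by omega : i ≤ j)]
  ring

/-! ### Bounded `x`-variables, homogeneity and a common preimage under trimming -/

/-- The polynomial `f` involves no `x_j` with `j ≥ m`. -/
def InFirstVars (m : ℕ) (f : PolTX) : Prop := truncX m f = f

namespace InFirstVars

variable {m : ℕ} {f g : PolTX}

theorem mono {k : ℕ} (hf : InFirstVars k f) (h : k ≤ m) : InFirstVars m f := by
  unfold InFirstVars at *
  rw [← hf, truncX_truncX h]

theorem insertT_eq (hf : InFirstVars m f) {p : ℕ} (h : m ≤ p) (a : ℕ) : insertT p a f = f := by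
  unfold InFirstVars at hf
  rw [← hf, insertT_truncX h]

theorem add (hf : InFirstVars m f) (hg : InFirstVars m g) : InFirstVars m (f + g) := by
  unfold InFirstVars at *
  rw [map_add, hf, hg]

theorem sub (hf : InFirstVars m f) (hg : InFirstVars m g) : InFirstVars m (f - g) := by
  unfold InFirstVars at *
  rw [map_sub, hf, hg]

theorem mul (hf : InFirstVars m f) (hg : InFirstVars m g) : InFirstVars m (f * g) := by
  unfold InFirstVars at *
  rw [map_mul, hf, hg]

theorem xVar_sub_tVar {i a : ℕ} (h : i < m) : InFirstVars m (xVar i - tVar a) := by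
  rw [InFirstVars, map_sub, truncX_xVar, if_pos h, truncX_tVar]

theorem omitT (hf : InFirstVars m f) (i : ℕ) : InFirstVars m (omitT i f) := by
  unfold InFirstVars at *
  rw [truncX_omitT, hf]

theorem zero : InFirstVars m 0 := map_zero _

theorem insertT (hf : InFirstVars (m + 1) f) {p : ℕ} (h : p ≤ m) (a : ℕ) :
    InFirstVars m (insertT p a f) := by
  unfold InFirstVars at *
  rw [truncX_insertT h, hf]

theorem trimAt (hf : InFirstVars (m + 1) f) {i : ℕ} (h : i < m) (a : ℕ) :
    InFirstVars m (trimAt i a f) := by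
  have h₁ := hf.insertT (by omega : i + 1 ≤ m) a
  have h₂ := hf.insertT h.le a
  have h₃ := h₁.sub h₂
  unfold InFirstVars at *
  rw [← mul_trimAt, map_mul, map_sub, truncX_xVar, if_pos h, truncX_tVar] at h₃
  exact mul_left_cancel₀ (xVar_sub_tVar_ne_zero i a) h₃

theorem trimAt_eq_zero (hf : InFirstVars m f) {i : ℕ} (h : m ≤ i) (a : ℕ) :
    _root_.trimAt i a f = 0 :=
  trimAt_eq_of_mul (by rw [hf.insertT_eq h, hf.insertT_eq (by omega)]; simp)

end InFirstVars

theorem isHomogeneous_xVar_sub_tVar (i a : ℕ) : (xVar i - tVar a).IsHomogeneous 1 :=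
  (isHomogeneous_X _ _).sub (isHomogeneous_X _ _)

theorem MvPolynomial.IsHomogeneous.insertT {f : PolTX} {d : ℕ} (hf : f.IsHomogeneous d)
    (p a : ℕ) : (insertT p a f).IsHomogeneous d := by
  have := MvPolynomial.IsHomogeneous.aeval hf (n := 1) (Sum.elim
    (fun j => if j < p then xVar j else if j = p then tVar a else xVar (j - 1)) tVar) fun v => by
      rcases v with j | j
      · simp only [Sum.elim_inl]
        split_ifs <;> exact isHomogeneous_X _ _
      · exact isHomogeneous_X _ _
  rwa [one_mul] at this

/-- The component of `f * g` in degree `d + k` is `f` times the component of `g` in degree `k`. For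
`k ≠ e` the former is zero, and `f` cancels. -/
theorem MvPolynomial.IsHomogeneous.of_mul_left {f g : PolTX} {d e : ℕ} (hf : f.IsHomogeneous d)
    (hf₀ : f ≠ 0) (hfg : (f * g).IsHomogeneous (d + e)) : g.IsHomogeneous e := by
  let _ : GradedAlgebra (homogeneousSubmodule (ℕ ⊕ ℕ) ℤ) := gradedAlgebra
  intro m hm
  by_contra h
  have hme : m.degree ≠ e := by rwa [Finsupp.degree_eq_weight_one]
  have h₀ := DirectSum.coe_decompose_mul_add_of_left_mem
    (homogeneousSubmodule (ℕ ⊕ ℕ) ℤ) (j := m.degree) (b := g) hf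
  have h₁ := DirectSum.decompose_of_mem_ne (homogeneousSubmodule (ℕ ⊕ ℕ) ℤ) hfg
    (j := d + m.degree) (by omega)
  rw [h₁, eq_comm, mul_eq_zero, or_iff_right hf₀] at h₀
  refine hm ?_
  have h₂ := coeff_homogeneousComponent m.degree g m
  rw [if_pos rfl] at h₂
  rw [← h₂]
  have h₃ : homogeneousComponent m.degree g = 0 := by
    rw [← decomposition.decompose'_apply]
    exact h₀
  rw [h₃, coeff_zero]

theorem MvPolynomial.IsHomogeneous.trimAt {f : PolTX} {d : ℕ} (hf : f.IsHomogeneous (d + 1))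
    (i a : ℕ) : (trimAt i a f).IsHomogeneous d := by
  refine (isHomogeneous_xVar_sub_tVar i a).of_mul_left (xVar_sub_tVar_ne_zero i a) ?_
  rw [mul_trimAt, add_comm 1 d]
  exact (hf.insertT _ _).sub (hf.insertT _ _)

theorem trimAt_xVar_sub_tVar_mul {i m : ℕ} (h : i < m) (b : ℕ) (g : PolTX) :
    trimAt i i ((xVar (m + 1) - tVar b) * g) = (xVar m - tVar b) * trimAt i i g := by
  refine trimAt_eq_of_mul ?_
  rw [mul_left_comm, mul_trimAt]
  simp only [map_mul, map_sub, insertT_tVar]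
  rw [insertT_xVar_succ_of_le (by omega), insertT_xVar_succ_of_le (by omega)]
  ring

/-- Compatible polynomials `g_i` are the images of a single polynomial under the trimming
operators. -/
theorem exists_trimAt_eq (d m : ℕ) : ∀ g : ℕ → PolTX,
    (∀ i < m, (g i).IsHomogeneous d) → (∀ i < m, InFirstVars m (g i)) →
    (∀ i k, i < k → k + 1 = m → InFirstVars k (g i)) →
    (∀ i j, i < j → j + 1 < m → trimAt j (j + 1) (g i) = trimAt i i (g (j + 1))) →
    ∃ f : PolTX, f.IsHomogeneous (d + 1) ∧ InFirstVars m f ∧ ∀ i < m, trimAt i i f = g i := by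
  induction m with
  | zero => exact fun _ _ _ _ _ => ⟨0, isHomogeneous_zero _ _ _, InFirstVars.zero, by simp⟩
  | succ m ih =>
    intro g hd hv hv' hc
    have hvm : ∀ i < m, InFirstVars m (g i) := fun i hi => hv' i m hi rfl
    -- `h` vanishes at `x_m = t_m`, so trimming it at `m` returns `g m`. The correction supplied by
    -- induction involves only `x_j` with `j < m`, so its trimming at `m` is zero.
    set h : PolTX := (xVar m - tVar m) * g m with h_def
    have hh : InFirstVars (m + 1) h :=
      (InFirstVars.xVar_sub_tVar (by omega)).mul (hv m (by omega))
    have hhd : h.IsHomogeneous (d + 1) := by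
      rw [add_comm]
      exact (isHomogeneous_xVar_sub_tVar m m).mul (hd m (by omega))
    obtain ⟨f, hf, hfv, hfg⟩ := ih (fun i => g i - trimAt i i h)
      (fun i hi => (hd i (by omega)).sub (hhd.trimAt i i))
      (fun i hi => (hvm i hi).sub (hh.trimAt hi i))
      (fun i k hik hkm => by
        subst hkm
        -- By compatibility the trimming of `h` is `(x_k - t_{k+1})` times a trimming of `g i` at
        -- `k`, that is, `g i` minus `g i` with `t_{k+1}` put for `x_k`. The difference therefore no
        -- longer involves `x_k`.
        have e : g i - trimAt i i h = insertT k (k + 1) (g i) := by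
          have h₁ := mul_trimAt k (k + 1) (g i)
          rw [(hvm i (by omega)).insertT_eq le_rfl] at h₁
          rw [h_def, trimAt_xVar_sub_tVar_mul hik, ← hc i k hik (by omega), h₁]
          ring
        simp only [e]
        exact (hvm i (by omega)).insertT le_rfl _)
      (fun i j hij hjm => by
        simp only [trimAt_sub]
        rw [hc i j hij (by omega), trimAt_trimAt hij])
    refine ⟨h + f, hhd.add hf, hh.add (hfv.mono (by omega)), fun i hi => ?_⟩
    rw [trimAt_add]
    rcases Nat.lt_succ_iff_lt_or_eq.mp hi with hi | rfl
    · rw [hfg i hi]; ring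
    · rw [hfv.trimAt_eq_zero le_rfl, add_zero]
      refine trimAt_eq_of_mul ?_
      rw [hh.insertT_eq le_rfl, h_def, map_mul, map_sub, insertT_tVar, insertT_xVar]
      simp

/-! ### Polynomials indexed by codes -/

/-- The increasing map that identifies `i` and `i + 1`. -/
def collapse (i b : ℕ) : ℕ := if b ≤ i then b else b - 1

/-- The code obtained from `c` by trimming at `i`. -/
def trimCode (c : Multiset ℕ) (i : ℕ) : Multiset ℕ := (c.erase i).map (collapse i)

/-- The positions at which a code may be trimmed. -/
def codeQDes (c : Multiset ℕ) (i : ℕ) : Prop := i ∈ c ∧ i + 1 ∉ c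

theorem mem_trimCode_of_lt {c : Multiset ℕ} {i j : ℕ} (h : i < j) :
    j ∈ trimCode c i ↔ j + 1 ∈ c := by
  simp only [trimCode, Multiset.mem_map, collapse]
  constructor
  · rintro ⟨b, hb, rfl⟩
    split_ifs at h ⊢ with hbi
    · omega
    · rw [Nat.sub_add_cancel (by omega)]
      exact Multiset.mem_of_mem_erase hb
  · intro hj
    exact ⟨j + 1, (Multiset.mem_erase_of_ne (by omega)).mpr hj, by rw [if_neg (by omega)]; rfl⟩

theorem mem_trimCode_of_gt {c : Multiset ℕ} {i j : ℕ} (h : j < i) :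
    j ∈ trimCode c i ↔ j ∈ c := by
  simp only [trimCode, Multiset.mem_map, collapse]
  constructor
  · rintro ⟨b, hb, rfl⟩
    split_ifs at h ⊢ with hbi
    · exact Multiset.mem_of_mem_erase hb
    · omega
  · intro hj
    exact ⟨j, (Multiset.mem_erase_of_ne (by omega)).mpr hj, by rw [if_pos (by omega)]⟩

theorem codeQDes_trimCode_of_lt {c : Multiset ℕ} {i j : ℕ} (h : i < j) :
    codeQDes (trimCode c i) j ↔ codeQDes c (j + 1) := by
  rw [codeQDes, codeQDes, mem_trimCode_of_lt h, mem_trimCode_of_lt (by omega)]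

theorem codeQDes_trimCode_of_gt {c : Multiset ℕ} {i j : ℕ} (h : i < j) :
    codeQDes (trimCode c (j + 1)) i ↔ codeQDes c i := by
  rw [codeQDes, codeQDes, mem_trimCode_of_gt (by omega), mem_trimCode_of_gt (by omega)]

theorem trimCode_trimCode {c : Multiset ℕ} {i j : ℕ} (h : i < j) (hi : i ∈ c) (hj : j + 1 ∈ c) :
    trimCode (trimCode c i) j = trimCode (trimCode c (j + 1)) i := by
  obtain ⟨c, rfl⟩ := Multiset.exists_cons_of_mem hi
  rw [Multiset.mem_cons, or_iff_right (by omega)] at hj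
  obtain ⟨c, rfl⟩ := Multiset.exists_cons_of_mem hj
  have e₁ : collapse i (j + 1) = j := by rw [collapse, if_neg (by omega)]; rfl
  have e₂ : collapse (j + 1) i = i := by rw [collapse, if_pos (by omega)]
  rw [trimCode, trimCode, Multiset.erase_cons_head, Multiset.map_cons, e₁,
    Multiset.erase_cons_head, Multiset.cons_swap, trimCode, trimCode, Multiset.erase_cons_head,
    Multiset.map_cons, e₂, Multiset.erase_cons_head, Multiset.map_map, Multiset.map_map]
  refine Multiset.map_congr rfl fun b _ => ?_
  simp only [Function.comp_apply, collapse]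
  split_ifs <;> omega

/-- A strict upper bound of a code. -/
def codeBound (c : Multiset ℕ) : ℕ := (c.map (· + 1)).sup

theorem codeBound_le {c : Multiset ℕ} {m : ℕ} : codeBound c ≤ m ↔ ∀ b ∈ c, b < m := by
  simp [codeBound, Multiset.sup_le]

open Classical in
/-- The conditions on the polynomial of the code `c`, in terms of those of the trimmed codes. -/
structure IsCodePoly (Q : Multiset ℕ → PolTX) (d : ℕ) (c : Multiset ℕ) (f : PolTX) : Prop where
  homogeneous : f.IsHomogeneous d
  inFirstVars : InFirstVars (codeBound c) f
  normalized : evPerm 1 f = if c = 0 then 1 else 0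
  trimming : ∀ i, trimAt i i f = if codeQDes c i then omitT i (Q (trimCode c i)) else 0

/-- The polynomial of a code `c` with `d` elements. -/
def codePoly : ℕ → Multiset ℕ → PolTX
  | 0, _ => 1
  | d + 1, c => Classical.epsilon (IsCodePoly (codePoly d) (d + 1) c)

theorem evPerm_one_rename_inr (g : PolT) : evPerm 1 (rename Sum.inr g) = g := by
  rw [evPerm, aeval_rename]
  simp

theorem truncX_rename_inr (m : ℕ) (g : PolT) :
    truncX m (rename Sum.inr g) = rename Sum.inr g := by
  have : (truncX m).comp (rename Sum.inr) = rename Sum.inr := by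
    refine algHom_ext fun j => ?_
    rw [AlgHom.comp_apply, rename_X]
    exact truncX_tVar m j
  exact DFunLike.congr_fun this g

theorem trimAt_rename_inr (i a : ℕ) (g : PolT) : trimAt i a (rename Sum.inr g) = 0 := by
  refine trimAt_eq_of_mul ?_
  rw [insertT, insertT, aeval_rename, aeval_rename]
  simp

theorem isHomogeneous_evPerm_one {f : PolTX} {d : ℕ} (hf : f.IsHomogeneous d) :
    (evPerm 1 f).IsHomogeneous d := by
  have := MvPolynomial.IsHomogeneous.aeval hf (n := 1)
    (Sum.elim (fun i => X ((1 : Equiv.Perm ℕ) i)) X : ℕ ⊕ ℕ → PolT)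
    fun v => by rcases v with j | j <;> exact isHomogeneous_X _ _
  rwa [one_mul] at this

theorem card_trimCode {c : Multiset ℕ} {i d : ℕ} (hi : i ∈ c) (hc : c.card = d + 1) :
    (trimCode c i).card = d := by
  rw [trimCode, Multiset.card_map, Multiset.card_erase_of_mem hi, hc]; rfl

/-- The prescribed trimmings are polynomials of degree one less, and the relations between them are
instances of the trimming conditions two degrees down. For `d = 0` the truncated `d - 1` is
harmless, since the empty code cannot be trimmed. -/
theorem isCodePoly_codePoly (d : ℕ) : ∀ c : Multiset ℕ, c.card = d →
    IsCodePoly (codePoly (d - 1)) d c (codePoly d c) := by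
  induction d with
  | zero =>
    intro c hc
    obtain rfl := Multiset.card_eq_zero.mp hc
    refine ⟨isHomogeneous_one _ _, map_one _, by simp [codePoly], fun i => ?_⟩
    rw [if_neg fun h => Multiset.notMem_zero i h.1]
    exact trimAt_eq_of_mul (by simp [codePoly])
  | succ d ih =>
    classical
    intro c hc
    rw [codePoly, Nat.add_sub_cancel]
    refine Classical.epsilon_spec (p := IsCodePoly (codePoly d) (d + 1) c) ?_
    have hQ : ∀ i ∈ c, IsCodePoly (codePoly (d - 1)) d (trimCode c i) (codePoly d (trimCode c i)) :=
      fun i hi => ih _ (card_trimCode hi hc)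
    set g : ℕ → PolTX := fun i => if codeQDes c i then omitT i (codePoly d (trimCode c i)) else 0
      with g_def
    -- For `i < j`, `omitT i` renames `t_j` to `t_{j+1}`, so trimming with parameter `j + 1` passes
    -- through it as the ordinary operator at `j`.
    have hgt : ∀ i j, i < j → codeQDes c i → trimAt j (j + 1) (g i) =
        if codeQDes c (j + 1) then
          omitT i (omitT j (codePoly (d - 1) (trimCode (trimCode c i) j))) else 0 := by
      intro i j hij hi
      have e := trimAt_omitT j j i (codePoly d (trimCode c i))
      rw [skip, if_neg (by omega), (hQ i hi.1).trimming, codeQDes_trimCode_of_lt hij] at e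
      simp only [g_def, if_pos hi, e]
      split_ifs <;> simp
    have hlt : ∀ i j, i < j → codeQDes c (j + 1) → trimAt i i (g (j + 1)) =
        if codeQDes c i then
          omitT (j + 1) (omitT i (codePoly (d - 1) (trimCode (trimCode c (j + 1)) i))) else 0 := by
      intro i j hij hj
      have e := trimAt_omitT i i (j + 1) (codePoly d (trimCode c (j + 1)))
      rw [skip, if_pos (by omega), (hQ _ hj.1).trimming, codeQDes_trimCode_of_gt hij] at e
      simp only [g_def, if_pos hj, e]
      split_ifs <;> simp
    have hbound : ∀ b ∈ c, b < codeBound c := codeBound_le.mp le_rfl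
    obtain ⟨f, hfd, hfv, hft⟩ := exists_trimAt_eq d (codeBound c) g
      (fun i _ => by
        simp only [g_def]
        split_ifs with h
        · exact (hQ i h.1).homogeneous.rename_isHomogeneous
        · exact isHomogeneous_zero _ _ _)
      (fun i _ => by
        simp only [g_def]
        split_ifs with h
        · refine ((hQ i h.1).inFirstVars.mono (codeBound_le.mpr fun b hb => ?_)).omitT i
          obtain ⟨b, hbc, rfl⟩ := Multiset.mem_map.mp hb
          have := hbound b (Multiset.mem_of_mem_erase hbc)
          rw [collapse]
          split_ifs <;> omega
        · exact InFirstVars.zero)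
      -- All entries of `c` are at most `k`, and those above `i` drop by one; since `i < k`, the
      -- trimmed code is bounded strictly by `k`.
      (fun i k hik hk => by
        simp only [g_def]
        split_ifs with h
        · refine ((hQ i h.1).inFirstVars.mono (codeBound_le.mpr fun b hb => ?_)).omitT i
          obtain ⟨b, hbc, rfl⟩ := Multiset.mem_map.mp hb
          have := hbound b (Multiset.mem_of_mem_erase hbc)
          rw [collapse]
          split_ifs <;> omega
        · exact InFirstVars.zero)
      (fun i j hij _ => by
        by_cases hi : codeQDes c i
        · rw [hgt i j hij hi]
          by_cases hj : codeQDes c (j + 1)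
          · rw [hlt i j hij hj, if_pos hi, if_pos hj, trimCode_trimCode hij hi.1 hj.1,
              omitT_omitT hij.le]
          · simp only [g_def, if_neg hj, trimAt_zero]
        · by_cases hj : codeQDes c (j + 1)
          · rw [hlt i j hij hj, if_neg hi]
            simp only [g_def, if_neg hi, trimAt_zero]
          · simp only [g_def, if_neg hi, if_neg hj, trimAt_zero])
    -- Subtracting `f(t; t)`, a polynomial in `t` alone, normalizes `f` without changing its
    -- trimmings.
    refine ⟨f - rename Sum.inr (evPerm 1 f),
      hfd.sub (isHomogeneous_evPerm_one hfd).rename_isHomogeneous, hfv.sub ?_, ?_, fun i => ?_⟩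
    · exact truncX_rename_inr _ _
    · rw [map_sub, evPerm_one_rename_inr, sub_self, if_neg]
      rintro rfl
      simp at hc
    · rw [trimAt_sub, trimAt_rename_inr, sub_zero]
      rcases lt_or_ge i (codeBound c) with hi | hi
      · exact hft i hi
      · rw [hfv.trimAt_eq_zero hi, if_neg]
        exact fun h => absurd (hbound i h.1) (by omega)

end

open BinaryTree (nil node numLeaves)

/-! ### Subtrees -/

theorem subtreeAt_nil_iff {a b : ℕ} {s : BinaryTree Unit} :
    SubtreeAt nil a s b ↔ s = nil ∧ b = a := by
  refine ⟨fun h => ?_, ?_⟩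
  · generalize ht : (nil : BinaryTree Unit) = t at h
    induction h with
    | root => exact ⟨rfl, rfl⟩
    | left _ ih => exact absurd ih.1 (by simp [← ht])
    | right _ ih => exact absurd ih.1 (by simp [← ht])
  · rintro ⟨rfl, rfl⟩
    exact .root

theorem SubtreeAt.of_left {l r s : BinaryTree Unit} {a b : ℕ} (h : SubtreeAt l a s b) :
    SubtreeAt (node () l r) a s b := by
  induction h with
  | root => exact .left .root
  | left _ ih => exact .left ih
  | right _ ih => exact .right ih

theorem SubtreeAt.of_right {l r s : BinaryTree Unit} {a b : ℕ}
    (h : SubtreeAt r (a + l.numLeaves) s b) : SubtreeAt (node () l r) a s b := by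
  induction h with
  | root => exact .right .root
  | left _ ih => exact .left ih
  | right _ ih => exact .right ih

theorem subtreeAt_node_iff {l r s : BinaryTree Unit} {a b : ℕ} :
    SubtreeAt (node () l r) a s b ↔
      (s = node () l r ∧ b = a) ∨ SubtreeAt l a s b ∨ SubtreeAt r (a + l.numLeaves) s b := by
  refine ⟨fun h => ?_, ?_⟩
  · induction h with
    | root => exact .inl ⟨rfl, rfl⟩
    | left _ ih =>
      rcases ih with ⟨he, rfl⟩ | h | h
      · cases he; exact .inr (.inl .root)
      · exact .inr (.inl h.left)
      · exact .inr (.inr h.left)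
    | right _ ih =>
      rcases ih with ⟨he, rfl⟩ | h | h
      · cases he; exact .inr (.inr .root)
      · exact .inr (.inl h.right)
      · exact .inr (.inr h.right)
  · rintro (⟨rfl, rfl⟩ | h | h)
    · exact .root
    · exact h.of_left
    · exact h.of_right

theorem numLeaves_node (l r : BinaryTree Unit) :
    (node () l r).numLeaves = l.numLeaves + r.numLeaves := rfl

theorem numLeaves_nil : (nil : BinaryTree Unit).numLeaves = 1 := rfl

/-- `IsTrimOf t a i t'`: if the leaves of `t` are numbered from `a`, then `t` has a terminal node
with leftmost leaf `i`, and `t'` arises from `t` by deleting it. -/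
inductive IsTrimOf : BinaryTree Unit → ℕ → ℕ → BinaryTree Unit → Prop
  | here (a : ℕ) : IsTrimOf (node () nil nil) a a nil
  | left {l l' r : BinaryTree Unit} {a i : ℕ} :
      IsTrimOf l a i l' → IsTrimOf (node () l r) a i (node () l' r)
  | right {l r r' : BinaryTree Unit} {a i : ℕ} :
      IsTrimOf r (a + l.numLeaves) i r' → IsTrimOf (node () l r) a i (node () l r')

namespace IsTrimOf

variable {t t' : BinaryTree Unit} {a i : ℕ}

theorem le (h : IsTrimOf t a i t') : a ≤ i := by
  induction h <;> omega

theorem numLeaves_eq (h : IsTrimOf t a i t') : t.numLeaves = t'.numLeaves + 1 := by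
  induction h with
  | here => rfl
  | left _ ih => simp only [numLeaves_node]; omega
  | right _ ih => simp only [numLeaves_node]; omega

theorem lt (h : IsTrimOf t a i t') : i + 1 < a + t.numLeaves := by
  induction h with
  | here => simp only [numLeaves_node, numLeaves_nil]; omega
  | left _ ih => simp only [numLeaves_node]; omega
  | right _ ih => simp only [numLeaves_node]; omega

end IsTrimOf

theorem trimTree_node {l r : BinaryTree Unit} (h : l ≠ nil ∨ r ≠ nil) (i : ℕ) :
    trimTree i (node () l r) = if i < l.numLeaves then node () (trimTree i l) r
      else node () l (trimTree (i - l.numLeaves) r) := by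
  rcases l with _ | ⟨⟨⟩, _, _⟩ <;> rcases r with _ | ⟨⟨⟩, _, _⟩ <;>
    first | rfl | simp at h

theorem isTrimOf_trimTree {t : BinaryTree Unit} {a i : ℕ}
    (h : SubtreeAt t a (node () nil nil) i) : IsTrimOf t a i (trimTree (i - a) t) := by
  induction t generalizing a with
  | nil => simp [subtreeAt_nil_iff] at h
  | node _ l r ihl ihr =>
    rcases subtreeAt_node_iff.mp h with ⟨he, rfl⟩ | h | h
    · cases he
      simpa [trimTree] using IsTrimOf.here i
    · have hl := ihl h
      have := hl.le
      have := hl.lt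
      rw [trimTree_node (.inl (by rintro rfl; simp [subtreeAt_nil_iff] at h)), if_pos (by omega)]
      exact .left hl
    · have hr := ihr h
      have := hr.le
      rw [trimTree_node (.inr (by rintro rfl; simp [subtreeAt_nil_iff] at h)), if_neg (by omega),
        Nat.sub_sub]
      exact .right hr

/-! ### Codes -/

/-- The leftmost leaves of the subtrees of the internal nodes of a tree with leaves numbered
from `a`. -/
def codeAt : BinaryTree Unit → ℕ → Multiset ℕ
  | .nil, _ => 0
  | .node _ l r, a => a ::ₘ (codeAt l a + codeAt r (a + l.numLeaves))

theorem mem_codeAt_node {l r : BinaryTree Unit} {a b : ℕ} : b ∈ codeAt (node () l r) a ↔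
    b = a ∨ b ∈ codeAt l a ∨ b ∈ codeAt r (a + l.numLeaves) := by
  simp [codeAt]

theorem bounds_of_mem_codeAt {t : BinaryTree Unit} {a b : ℕ} (h : b ∈ codeAt t a) :
    a ≤ b ∧ b + 1 < a + t.numLeaves := by
  induction t generalizing a with
  | nil => simp [codeAt] at h
  | node _ l r ihl ihr =>
    have := l.numLeaves_pos
    have := r.numLeaves_pos
    rw [numLeaves_node]
    rcases mem_codeAt_node.mp h with rfl | h | h
    · omega
    · have := ihl h; omega
    · have := ihr h; omega

theorem mem_codeAt_self {t : BinaryTree Unit} (h : t ≠ nil) (a : ℕ) : a ∈ codeAt t a := by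
  rcases t with _ | ⟨⟨⟩, l, r⟩
  · exact absurd rfl h
  · simp [codeAt]

/-- The lowest internal node whose leftmost leaf is `i` has the leaf `i` as left child. Its right
child starts at `i + 1`, and is a leaf exactly when no internal node starts there. -/
theorem subtreeAt_terminal_iff {t : BinaryTree Unit} {a i : ℕ} :
    SubtreeAt t a (node () nil nil) i ↔ i ∈ codeAt t a ∧ i + 1 ∉ codeAt t a := by
  induction t generalizing a with
  | nil => simp [subtreeAt_nil_iff, codeAt]
  | node _ l r ihl ihr =>
    rw [subtreeAt_node_iff, mem_codeAt_node, mem_codeAt_node, ihl, ihr]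
    have := l.numLeaves_pos
    constructor
    · rintro (⟨h, rfl⟩ | ⟨h, h'⟩ | ⟨h, h'⟩)
      · cases h
        simp [codeAt]
      · have := bounds_of_mem_codeAt h
        refine ⟨.inr (.inl h), ?_⟩
        rintro (h₀ | h₀ | h₀)
        · omega
        · exact h' h₀
        · have := bounds_of_mem_codeAt h₀; omega
      · have := bounds_of_mem_codeAt h
        refine ⟨.inr (.inr h), ?_⟩
        rintro (h₀ | h₀ | h₀)
        · omega
        · have := bounds_of_mem_codeAt h₀; omega
        · exact h' h₀
    · rintro ⟨h, h'⟩
      simp only [not_or] at h'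
      rcases h with rfl | h | h
      · by_cases hl : l = nil
        · subst hl
          by_cases hr : r = nil
          · subst hr
            exact .inl ⟨rfl, rfl⟩
          · exact absurd (mem_codeAt_self hr _) h'.2.2
        · exact .inr (.inl ⟨mem_codeAt_self hl _, h'.2.1⟩)
      · exact .inr (.inl ⟨h, h'.2.1⟩)
      · exact .inr (.inr ⟨h, h'.2.2⟩)

/-- The increasing map whose range omits exactly `i + 1`. -/
def skipNext (i b : ℕ) : ℕ := if b ≤ i then b else b + 1

theorem map_skipNext_codeAt_of_le {t : BinaryTree Unit} {a i : ℕ} (h : a + t.numLeaves ≤ i + 1) :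
    (codeAt t a).map (skipNext i) = codeAt t a := by
  conv_rhs => rw [← Multiset.map_id (codeAt t a)]
  refine Multiset.map_congr rfl fun b hb => ?_
  have := bounds_of_mem_codeAt hb
  rw [skipNext, if_pos (by omega), id]

theorem map_skipNext_codeAt_of_lt {t : BinaryTree Unit} {a i : ℕ} (h : i < a) :
    (codeAt t a).map (skipNext i) = codeAt t (a + 1) := by
  induction t generalizing a with
  | nil => rfl
  | node _ l r ihl ihr =>
    rw [codeAt, codeAt, Multiset.map_cons, Multiset.map_add, ihl h, ihr (by omega), skipNext,
      if_neg (by omega), Nat.add_right_comm]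

/-- Trimming merges the leaves `i` and `i + 1`. A remaining subtree that begins at the merged leaf
began at `i`, so the number skipped is `i + 1`. -/
theorem IsTrimOf.codeAt_eq {t t' : BinaryTree Unit} {a i : ℕ} (h : IsTrimOf t a i t') :
    codeAt t a = i ::ₘ (codeAt t' a).map (skipNext i) := by
  induction h with
  | here => simp [codeAt]
  | @left l l' r a i h ih =>
    have e := h.numLeaves_eq
    have := h.lt
    have := h.le
    rw [codeAt, codeAt, Multiset.map_cons, Multiset.map_add, ih,
      map_skipNext_codeAt_of_lt (t := r) (by omega), Multiset.cons_add, Multiset.cons_swap, skipNext,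
      if_pos (by omega), e, Nat.add_assoc]
  | @right l r r' a i h ih =>
    have := h.le
    have := l.numLeaves_pos
    rw [codeAt, codeAt, Multiset.map_cons, Multiset.map_add, ih,
      map_skipNext_codeAt_of_le (t := l) (by omega), Multiset.add_cons, Multiset.cons_swap, skipNext,
      if_pos (by omega)]

/-! ### Labels and edges -/

/-- The root of the tree is internal, with canonical label `q`. -/
def RootLabel : BinaryTree Unit → ℕ → ℕ → Prop
  | .nil, _, _ => False
  | .node _ l _, a, q => q = a + l.numLeaves - 1

/-- Some internal node with canonical label `p` has an internal child with canonical
label `q`. -/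
def LabelEdge : BinaryTree Unit → ℕ → ℕ → ℕ → Prop
  | .nil, _, _, _ => False
  | .node _ l r, a, p, q =>
      (p = a + l.numLeaves - 1 ∧ (RootLabel l a q ∨ RootLabel r (a + l.numLeaves) q)) ∨
        LabelEdge l a p q ∨ LabelEdge r (a + l.numLeaves) p q

theorem RootLabel.bounds {t : BinaryTree Unit} {a q : ℕ} (h : RootLabel t a q) :
    a ≤ q ∧ q + 1 < a + t.numLeaves := by
  rcases t with _ | ⟨⟨⟩, l, r⟩
  · exact h.elim
  · have := l.numLeaves_pos
    have := r.numLeaves_pos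
    rw [RootLabel] at h
    rw [numLeaves_node]
    omega

theorem LabelEdge.bounds {t : BinaryTree Unit} {a p q : ℕ} (h : LabelEdge t a p q) :
    (a ≤ p ∧ p + 1 < a + t.numLeaves) ∧ a ≤ q ∧ q + 1 < a + t.numLeaves := by
  induction t generalizing a with
  | nil => exact h.elim
  | node _ l r ihl ihr =>
    have := l.numLeaves_pos
    have := r.numLeaves_pos
    rw [numLeaves_node]
    rcases h with ⟨rfl, h | h⟩ | h | h
    · have := h.bounds; omega
    · have := h.bounds; omega
    · have := ihl h; omega
    · have := ihr h; omega

/-- Every leaf of a tree except the last is a canonical label: the root takes the last leaf of its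
left subtree, and the two subtrees provide the others. -/
theorem exists_subtreeAt_nodeLabel_iff {t : BinaryTree Unit} {a q : ℕ} :
    (∃ l r b, SubtreeAt t a (node () l r) b ∧ q = IndexedForest.nodeLabel l b) ↔
      a ≤ q ∧ q + 1 < a + t.numLeaves := by
  induction t generalizing a with
  | nil =>
    simp only [subtreeAt_nil_iff, numLeaves_nil]
    constructor
    · rintro ⟨_, _, _, ⟨⟨⟩, _⟩, _⟩
    · omega
  | node _ l r ihl ihr =>
    have := l.numLeaves_pos
    have := r.numLeaves_pos
    rw [numLeaves_node]
    constructor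
    · rintro ⟨l', r', b, h, rfl⟩
      rcases subtreeAt_node_iff.mp h with ⟨he, rfl⟩ | h | h
      · cases he
        rw [IndexedForest.nodeLabel]
        omega
      · have := ihl.mp ⟨_, _, _, h, rfl⟩; omega
      · have := ihr.mp ⟨_, _, _, h, rfl⟩; omega
    · intro h
      rcases lt_trichotomy (q + 1) (a + l.numLeaves) with h' | h' | h'
      · obtain ⟨l', r', b, hs, hq⟩ := ihl.mpr ⟨h.1, h'⟩
        exact ⟨l', r', b, hs.of_left, hq⟩
      · exact ⟨l, r, a, .root, by rw [IndexedForest.nodeLabel]; omega⟩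
      · obtain ⟨l', r', b, hs, hq⟩ := (ihr (a := a + l.numLeaves)).mpr (by omega)
        exact ⟨l', r', b, hs.of_right, hq⟩

theorem labelEdge_iff {t : BinaryTree Unit} {a p q : ℕ} : LabelEdge t a p q ↔
    ∃ l r b, SubtreeAt t a (node () l r) b ∧ p = IndexedForest.nodeLabel l b ∧
      (RootLabel l b q ∨ RootLabel r (b + l.numLeaves) q) := by
  induction t generalizing a with
  | nil =>
    simp only [subtreeAt_nil_iff]
    constructor
    · exact False.elim
    · rintro ⟨_, _, _, ⟨⟨⟩, _⟩, _⟩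
  | node _ l r ihl ihr =>
    rw [LabelEdge, ihl, ihr]
    constructor
    · rintro (⟨h, h'⟩ | ⟨l', r', b, h, h'⟩ | ⟨l', r', b, h, h'⟩)
      · exact ⟨l, r, a, .root, h, h'⟩
      · exact ⟨l', r', b, h.of_left, h'⟩
      · exact ⟨l', r', b, h.of_right, h'⟩
    · rintro ⟨l', r', b, h, h'⟩
      rcases subtreeAt_node_iff.mp h with ⟨he, rfl⟩ | h | h
      · cases he
        exact .inl h'
      · exact .inr (.inl ⟨l', r', b, h, h'⟩)
      · exact .inr (.inr ⟨l', r', b, h, h'⟩)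

theorem rootLabel_skip_of_le {t : BinaryTree Unit} {a i q : ℕ} (h : a + t.numLeaves ≤ i + 1) :
    RootLabel t a (skip i q) ↔ RootLabel t a q := by
  unfold skip
  split_ifs
  · rfl
  · exact ⟨fun h => by have := h.bounds; omega, fun h => by have := h.bounds; omega⟩

theorem labelEdge_skip_of_le {t : BinaryTree Unit} {a i p q : ℕ}
    (h : a + t.numLeaves ≤ i + 1) :
    LabelEdge t a (skip i p) (skip i q) ↔ LabelEdge t a p q := by
  unfold skip
  split_ifs <;> first
    | rfl
    | exact ⟨fun h => by have := h.bounds; omega, fun h => by have := h.bounds; omega⟩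

theorem rootLabel_add_one {t : BinaryTree Unit} {a q : ℕ} :
    RootLabel t (a + 1) (q + 1) ↔ RootLabel t a q := by
  rcases t with _ | ⟨⟨⟩, l, r⟩
  · rfl
  · have := l.numLeaves_pos
    simp only [RootLabel]
    omega

theorem labelEdge_add_one {t : BinaryTree Unit} {a p q : ℕ} :
    LabelEdge t (a + 1) (p + 1) (q + 1) ↔ LabelEdge t a p q := by
  induction t generalizing a with
  | nil => rfl
  | node _ l r ihl ihr =>
    have := l.numLeaves_pos
    rw [LabelEdge, LabelEdge, ihl, Nat.add_right_comm, ihr, rootLabel_add_one, rootLabel_add_one]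
    have : p + 1 = a + l.numLeaves + 1 - 1 ↔ p = a + l.numLeaves - 1 := by omega
    rw [this]

theorem rootLabel_skip_of_ge {t : BinaryTree Unit} {a i q : ℕ} (h : i ≤ a) :
    RootLabel t (a + 1) (skip i q) ↔ RootLabel t a q := by
  unfold skip
  split_ifs
  · exact ⟨fun h => by have := h.bounds; omega, fun h => by have := h.bounds; omega⟩
  · exact rootLabel_add_one

theorem labelEdge_skip_of_ge {t : BinaryTree Unit} {a i p q : ℕ} (h : i ≤ a) :
    LabelEdge t (a + 1) (skip i p) (skip i q) ↔ LabelEdge t a p q := by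
  unfold skip
  split_ifs <;> first
    | exact labelEdge_add_one
    | exact ⟨fun h => by have := h.bounds; omega, fun h => by have := h.bounds; omega⟩

namespace IsTrimOf

variable {t t' : BinaryTree Unit} {a i : ℕ}

theorem rootLabel_iff (h : IsTrimOf t a i t') {q : ℕ} :
    RootLabel t a (skip i q) ↔ RootLabel t' a q := by
  cases h with
  | here =>
    simp only [RootLabel, numLeaves_nil, Nat.add_sub_cancel, iff_false]
    exact skip_ne _ _
  | left h =>
    have := h.numLeaves_eq
    have := h.lt
    simp only [RootLabel, skip]
    split_ifs <;> omega
  | @right l r r' a i h =>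
    have := h.le
    have := l.numLeaves_pos
    simp only [RootLabel, skip]
    split_ifs <;> omega

/-- A label is the right end of a left subtree, so one at the merged leaf was `i + 1` before
trimming. Hence labels skip `i`, the label of the deleted node, whereas codes skip `i + 1`. -/
theorem labelEdge_iff (h : IsTrimOf t a i t') {p q : ℕ} :
    LabelEdge t a (skip i p) (skip i q) ↔ LabelEdge t' a p q := by
  induction h with
  | here => simp [LabelEdge, RootLabel]
  | @left l l' r a i h ih =>
    have e := h.numLeaves_eq
    have := h.lt
    have hp : skip i p = a + l.numLeaves - 1 ↔ p = a + l'.numLeaves - 1 := by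
      rw [skip]
      split_ifs <;> omega
    rw [LabelEdge, LabelEdge, ih, h.rootLabel_iff, hp, e, ← Nat.add_assoc,
      rootLabel_skip_of_ge (by omega), labelEdge_skip_of_ge (by omega)]
  | @right l r r' a i h ih =>
    have := h.le
    have := l.numLeaves_pos
    have hp : skip i p = a + l.numLeaves - 1 ↔ p = a + l.numLeaves - 1 := by
      rw [skip]
      split_ifs <;> omega
    rw [LabelEdge, LabelEdge, ih, h.rootLabel_iff, hp, rootLabel_skip_of_le (by omega),
      labelEdge_skip_of_le (by omega)]

theorem not_labelEdge (h : IsTrimOf t a i t') (q : ℕ) : ¬ LabelEdge t a i q := by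
  induction h with
  | here => simp [LabelEdge, RootLabel]
  | @left l l' r a i h ih =>
    have := h.lt
    rintro (⟨_, _⟩ | h' | h')
    · omega
    · exact ih h'
    · have := h'.bounds; omega
  | @right l r r' a i h ih =>
    have := h.le
    have := l.numLeaves_pos
    rintro (⟨_, _⟩ | h' | h')
    · omega
    · have := h'.bounds; omega
    · exact ih h'

end IsTrimOf

/-! ### Trimming forests -/

namespace IndexedForest

variable {F : IndexedForest} {i : ℕ}

theorem firstLeaf_succ (F : IndexedForest) (k : ℕ) :
    F.firstLeaf (k + 1) = F.firstLeaf k + (F.trees k).numLeaves :=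
  Finset.sum_range_succ _ _

theorem firstLeaf_mono (F : IndexedForest) : Monotone F.firstLeaf :=
  monotone_nat_of_le_succ fun k => by rw [firstLeaf_succ]; omega

theorem firstLeaf_add_le (F : IndexedForest) {k k' : ℕ} (h : k < k') :
    F.firstLeaf k + (F.trees k).numLeaves ≤ F.firstLeaf k' :=
  F.firstLeaf_succ k ▸ F.firstLeaf_mono h

/-- The effect of trimming a forest on its trees and their positions. -/
theorem exists_isTrimOf (h : i ∈ F.qdes) : ∃ k₀, IsTrimOf (F.trees k₀) (F.firstLeaf k₀) i
      ((F.trim i).trees k₀) ∧ (∀ k ≠ k₀, (F.trim i).trees k = F.trees k) ∧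
      (∀ k ≤ k₀, (F.trim i).firstLeaf k = F.firstLeaf k) ∧
      ∀ k, k₀ < k → F.firstLeaf k = (F.trim i).firstLeaf k + 1 := by
  obtain ⟨k₀, hk⟩ := h
  have ht := isTrimOf_trimTree hk
  have h₁ := ht.le
  have h₂ := ht.lt
  have e₀ : (F.trim i).trees k₀ = trimTree (i - F.firstLeaf k₀) (F.trees k₀) := by
    refine if_pos ?_
    rw [firstLeaf_succ]
    omega
  have e₁ : ∀ k ≠ k₀, (F.trim i).trees k = F.trees k := fun k hk => by
    refine if_neg ?_
    rintro ⟨h₃, h₄⟩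
    rw [firstLeaf_succ] at h₄
    rcases lt_or_gt_of_ne hk with hk | hk <;> have := F.firstLeaf_add_le hk <;> omega
  have e₂ : ∀ k ≤ k₀, (F.trim i).firstLeaf k = F.firstLeaf k := fun k hk =>
    Finset.sum_congr rfl fun j hj => by
      rw [e₁ j]
      have := Finset.mem_range.mp hj
      omega
  refine ⟨k₀, e₀ ▸ ht, e₁, e₂, fun k hk => ?_⟩
  induction k, hk using Nat.le_induction with
  | base =>
    rw [firstLeaf_succ, firstLeaf_succ, e₂ k₀ le_rfl, e₀, ht.numLeaves_eq]
    rfl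
  | succ k hk ih => rw [firstLeaf_succ, firstLeaf_succ, ih, e₁ k (by omega)]; omega

/-- The leftmost leaves of the subtrees of the internal nodes of a forest. -/
noncomputable def code (F : IndexedForest) : Multiset ℕ :=
  ∑ k ∈ F.finite_nontrivial.toFinset, codeAt (F.trees k) (F.firstLeaf k)

theorem code_eq_sum {s : Finset ℕ} (h : F.finite_nontrivial.toFinset ⊆ s) :
    F.code = ∑ k ∈ s, codeAt (F.trees k) (F.firstLeaf k) := by
  refine Finset.sum_subset h fun k _ hk => ?_
  have : F.trees k = nil := by simpa using hk
  rw [this, codeAt]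

theorem mem_code {b : ℕ} : b ∈ F.code ↔ ∃ k, b ∈ codeAt (F.trees k) (F.firstLeaf k) := by
  rw [code, Multiset.mem_sum]
  refine ⟨fun ⟨k, _, h⟩ => ⟨k, h⟩, fun ⟨k, h⟩ => ⟨k, ?_, h⟩⟩
  rw [Set.Finite.mem_toFinset]
  intro hk
  simp [hk, codeAt] at h

theorem code_eq_zero_iff : F.code = 0 ↔ F = empty := by
  constructor
  · intro h
    ext1
    funext k
    by_contra hk
    have := mem_code.mpr ⟨k, mem_codeAt_self hk (F.firstLeaf k)⟩
    simp [h] at this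
  · rintro rfl
    simp [code, empty, codeAt]

theorem tree_index_unique {k k' b : ℕ} (h₁ : F.firstLeaf k ≤ b)
    (h₂ : b < F.firstLeaf k + (F.trees k).numLeaves) (h₃ : F.firstLeaf k' ≤ b)
    (h₄ : b < F.firstLeaf k' + (F.trees k').numLeaves) : k = k' := by
  by_contra hk
  rcases lt_or_gt_of_ne hk with hk | hk
  · have := F.firstLeaf_add_le hk; omega
  · have := F.firstLeaf_add_le hk; omega

theorem mem_qdes_iff : i ∈ F.qdes ↔ codeQDes F.code i := by
  rw [codeQDes, mem_code, mem_code]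
  constructor
  · rintro ⟨k, hk⟩
    have hk' := isTrimOf_trimTree hk
    have h₁ := hk'.le
    have h₂ := hk'.lt
    rw [subtreeAt_terminal_iff] at hk
    refine ⟨⟨k, hk.1⟩, ?_⟩
    rintro ⟨k', h'⟩
    have h₃ := bounds_of_mem_codeAt h'
    obtain rfl := tree_index_unique (by omega) h₂ h₃.1 (by omega)
    exact hk.2 h'
  · rintro ⟨⟨k, hk⟩, h⟩
    exact ⟨k, subtreeAt_terminal_iff.mpr ⟨hk, fun h' => h ⟨k, h'⟩⟩⟩

theorem code_eq_cons (h : i ∈ F.qdes) : F.code = i ::ₘ (F.trim i).code.map (skipNext i) := by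
  classical
  obtain ⟨k₀, ht, h₁, h₂, h₃⟩ := exists_isTrimOf h
  -- A common index set for the two sums is needed, since trimming may make tree `k₀` trivial.
  set s := insert k₀ (F.finite_nontrivial.toFinset ∪ (F.trim i).finite_nontrivial.toFinset)
  have hk₀ : k₀ ∈ s := Finset.mem_insert_self _ _
  rw [code_eq_sum (s := s) (fun k hk => by simp [s] at hk ⊢; tauto),
    code_eq_sum (F := F.trim i) (s := s) (fun k hk => by simp [s] at hk ⊢; tauto),
    ← Finset.add_sum_erase _ _ hk₀, ← Finset.add_sum_erase _ _ hk₀, Multiset.map_add,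
    ← Multiset.cons_add, h₂ k₀ le_rfl, ← ht.codeAt_eq,
    ← Multiset.coe_mapAddMonoidHom (skipNext i), map_sum]
  congr 1
  refine Finset.sum_congr rfl fun k hk => ?_
  have hk := Finset.ne_of_mem_erase hk
  rw [Multiset.coe_mapAddMonoidHom, h₁ k hk]
  rcases lt_or_gt_of_ne hk with hk | hk
  · have h₄ := F.firstLeaf_add_le hk
    have := ht.le
    rw [h₂ k hk.le, map_skipNext_codeAt_of_le (by omega)]
  · have h₄ := F.firstLeaf_add_le hk
    have := ht.lt
    have := h₃ k hk
    rw [h₃ k hk, map_skipNext_codeAt_of_lt (by omega)]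

theorem code_trim (h : i ∈ F.qdes) : (F.trim i).code = trimCode F.code i := by
  rw [code_eq_cons h, trimCode, Multiset.erase_cons_head, Multiset.map_map]
  conv_lhs => rw [← Multiset.map_id (F.trim i).code]
  refine Multiset.map_congr rfl fun b _ => ?_
  simp only [Function.comp_apply, collapse, skipNext, id]
  split_ifs <;> omega

end IndexedForest

/-! ### Existence of the double forest polynomials -/

theorem isDoubleForestFamily_codePoly :
    IsDoubleForestFamily fun F => codePoly F.code.card F.code := by
  classical
  have h := fun F : IndexedForest => isCodePoly_codePoly F.code.card F.code rfl
  refine ⟨fun F => ⟨_, (h F).homogeneous⟩, fun F => ?_, fun F i => ?_⟩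
  · rw [(h F).normalized]
    simp only [IndexedForest.code_eq_zero_iff]
  · rw [eqTrim_eq_trimAt, (h F).trimming]
    by_cases hi : i ∈ F.qdes
    · have hi' := IndexedForest.mem_qdes_iff.mp hi
      have hc : 0 < F.code.card := Multiset.card_pos_iff_exists_mem.mpr ⟨i, hi'.1⟩
      rw [if_pos hi, if_pos hi', IndexedForest.code_trim hi,
        card_trimCode hi'.1 (d := F.code.card - 1) (by omega)]
    · rw [if_neg hi, if_neg (mt IndexedForest.mem_qdes_iff.mpr hi)]

/-- Choice returns some family with the defining properties as soon as one exists; the evaluation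
formula holds for any such family. -/
theorem isDoubleForestFamily_doubleForestPoly : IsDoubleForestFamily doubleForestPoly :=
  Classical.epsilon_spec ⟨_, isDoubleForestFamily_codePoly⟩

/-! ### Sylvester words -/

namespace IndexedForest

variable {F : IndexedForest} {i : ℕ}

/-- `q` is a canonical label of the forest. -/
def HasLabel (F : IndexedForest) (q : ℕ) : Prop :=
  ∃ k, F.firstLeaf k ≤ q ∧ q + 1 < F.firstLeaf k + (F.trees k).numLeaves

/-- `p` and `q` are the canonical labels of an internal node and of one of its children. -/
def HasEdge (F : IndexedForest) (p q : ℕ) : Prop :=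
  ∃ k, LabelEdge (F.trees k) (F.firstLeaf k) p q

theorem HasEdge.hasLabel_left {p q : ℕ} (h : F.HasEdge p q) : F.HasLabel p :=
  h.imp fun _ h => h.bounds.1

theorem HasEdge.hasLabel_right {p q : ℕ} (h : F.HasEdge p q) : F.HasLabel q :=
  h.imp fun _ h => h.bounds.2

theorem hasLabel_iff {q : ℕ} : F.HasLabel q ↔
    ∃ l r b, F.HasSubtree (node () l r) b ∧ q = nodeLabel l b := by
  constructor
  · rintro ⟨k, h⟩
    obtain ⟨l, r, b, h, h'⟩ := exists_subtreeAt_nodeLabel_iff.mpr h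
    exact ⟨l, r, b, ⟨k, h⟩, h'⟩
  · rintro ⟨l, r, b, ⟨k, h⟩, h'⟩
    exact ⟨k, exists_subtreeAt_nodeLabel_iff.mp ⟨l, r, b, h, h'⟩⟩

theorem isSylvester_iff {w : List ℕ} : F.IsSylvester w ↔
    w.Nodup ∧ (∀ q, q ∈ w ↔ F.HasLabel q) ∧ ∀ p q, F.HasEdge p q → w.idxOf p < w.idxOf q := by
  constructor
  · intro h
    refine ⟨h.nodup, fun q => by rw [h.mem_iff, hasLabel_iff], fun p q => ?_⟩
    rintro ⟨k, he⟩
    obtain ⟨l, r, b, hs, rfl, hq | hq⟩ := labelEdge_iff.mp he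
    · rcases l with _ | ⟨⟨⟩, l₁, l₂⟩
      · exact hq.elim
      · exact hq ▸ h.before_left l₁ l₂ r b ⟨k, hs⟩
    · rcases r with _ | ⟨⟨⟩, r₁, r₂⟩
      · exact hq.elim
      · exact hq ▸ h.before_right l r₁ r₂ b ⟨k, hs⟩
  · rintro ⟨h₁, h₂, h₃⟩
    refine ⟨h₁, fun q => by rw [h₂, hasLabel_iff], ?_, ?_⟩
    · rintro l₁ l₂ r b ⟨k, hs⟩
      exact h₃ _ _ ⟨k, labelEdge_iff.mpr ⟨_, _, _, hs, rfl, .inl rfl⟩⟩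
    · rintro l r₁ r₂ b ⟨k, hs⟩
      exact h₃ _ _ ⟨k, labelEdge_iff.mpr ⟨_, _, _, hs, rfl, .inr rfl⟩⟩

theorem hasEdge_skip (h : i ∈ F.qdes) (p q : ℕ) :
    F.HasEdge (skip i p) (skip i q) ↔ (F.trim i).HasEdge p q := by
  obtain ⟨k₀, ht, h₁, h₂, h₃⟩ := exists_isTrimOf h
  refine exists_congr fun k => ?_
  rcases lt_trichotomy k k₀ with hk | rfl | hk
  · have h₄ := F.firstLeaf_add_le hk
    have := ht.le
    rw [h₂ k hk.le, h₁ k hk.ne, labelEdge_skip_of_le (by omega)]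
  · rw [h₂ k le_rfl, ht.labelEdge_iff]
  · have h₄ := F.firstLeaf_add_le hk
    have := ht.lt
    have := h₃ k hk
    rw [h₃ k hk, h₁ k hk.ne', labelEdge_skip_of_ge (by omega)]

theorem hasLabel_skip (h : i ∈ F.qdes) (q : ℕ) :
    F.HasLabel (skip i q) ↔ (F.trim i).HasLabel q := by
  obtain ⟨k₀, ht, h₁, h₂, h₃⟩ := exists_isTrimOf h
  refine exists_congr fun k => ?_
  have := ht.le
  have := ht.lt
  rcases lt_trichotomy k k₀ with hk | rfl | hk
  · have h₄ := F.firstLeaf_add_le hk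
    rw [h₂ k hk.le, h₁ k hk.ne, skip]
    split_ifs <;> omega
  · rw [h₂ k le_rfl, ht.numLeaves_eq, skip]
    have := ht.numLeaves_eq
    split_ifs <;> omega
  · have h₄ := F.firstLeaf_add_le hk
    have := h₃ k hk
    rw [h₃ k hk, h₁ k hk.ne', skip]
    split_ifs <;> omega

theorem not_hasEdge_of_mem_qdes (h : i ∈ F.qdes) (q : ℕ) : ¬ F.HasEdge i q := by
  rintro ⟨k, he⟩
  obtain ⟨k₀, hk⟩ := h
  have ht := isTrimOf_trimTree hk
  have h₁ := ht.le
  have h₂ := ht.lt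
  have h₃ := he.bounds
  obtain rfl := tree_index_unique h₁ (by omega) h₃.1.1 (by omega)
  exact ht.not_labelEdge q he

theorem hasLabel_of_mem_qdes (h : i ∈ F.qdes) : F.HasLabel i := by
  obtain ⟨k₀, hk⟩ := h
  exact ⟨k₀, (isTrimOf_trimTree hk).le, (isTrimOf_trimTree hk).lt⟩

theorem mem_qdes_of_not_hasEdge (h : F.HasLabel i) (h' : ∀ q, ¬ F.HasEdge i q) : i ∈ F.qdes := by
  obtain ⟨l, r, b, ⟨k, hs⟩, rfl⟩ := hasLabel_iff.mp h
  rcases l with _ | ⟨⟨⟩, l₁, l₂⟩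
  · rcases r with _ | ⟨⟨⟩, r₁, r₂⟩
    · exact ⟨k, by simpa [nodeLabel] using hs⟩
    · exact absurd ⟨k, labelEdge_iff.mpr ⟨_, _, _, hs, rfl, .inr rfl⟩⟩ (h' _)
  · exact absurd ⟨k, labelEdge_iff.mpr ⟨_, _, _, hs, rfl, .inl rfl⟩⟩ (h' _)

theorem isSylvester_nil_iff : F.IsSylvester [] ↔ F = empty := by
  rw [isSylvester_iff]
  constructor
  · rintro ⟨-, h, -⟩
    ext1
    funext k
    by_contra hk
    have h₁ := bounds_of_mem_codeAt (mem_codeAt_self hk (F.firstLeaf k))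
    simpa using (h _).mpr ⟨k, h₁⟩
  · rintro rfl
    refine ⟨List.nodup_nil, fun q => ?_, ?_⟩
    · simp only [List.not_mem_nil, false_iff]
      rintro ⟨k, h⟩
      simp only [empty, numLeaves_nil] at h
      omega
    · rintro p q ⟨k, h⟩
      exact h.elim

end IndexedForest

theorem idxOf_map_skip (i j : ℕ) (w : List ℕ) :
    (w.map (skip i)).idxOf (skip i j) = w.idxOf j := by
  induction w with
  | nil => rfl
  | cons a w ih =>
    by_cases h : a = j
    · simp [h]
    · rw [List.map_cons, List.idxOf_cons_ne _ h, List.idxOf_cons_ne _ ((skip_injective i).ne h), ih]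

namespace IndexedForest

variable {F : IndexedForest} {i : ℕ}

/-- `skip i` identifies the labels and edges of `F / i` with those of `F` that avoid `i`. The
deleted node has no internal child, so the only order condition on its label is to follow its
parent, which holds in last place. -/
theorem isSylvester_map_skip_append (h : i ∈ F.qdes) (w : List ℕ) :
    F.IsSylvester (w.map (skip i) ++ [i]) ↔ (F.trim i).IsSylvester w := by
  have hi : i ∉ w.map (skip i) := fun h => by
    obtain ⟨j, _, hj⟩ := List.mem_map.mp h
    exact skip_ne i j hj
  have hmem : ∀ q, skip i q ∈ w.map (skip i) ++ [i] ↔ q ∈ w := fun q => by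
    simp [skip_ne, (skip_injective i).eq_iff]
  have hidx : ∀ q ∈ w, (w.map (skip i) ++ [i]).idxOf (skip i q) = w.idxOf q := fun q hq => by
    rw [List.idxOf_append_of_mem (List.mem_map_of_mem hq), idxOf_map_skip]
  rw [isSylvester_iff, isSylvester_iff]
  constructor
  · rintro ⟨h₁, h₂, h₃⟩
    have hm : ∀ q, q ∈ w ↔ (F.trim i).HasLabel q := fun q => by
      rw [← hmem, h₂, hasLabel_skip h]
    refine ⟨(h₁.of_append_left).of_map _, hm, fun p q he => ?_⟩
    rw [← hidx p ((hm p).mpr he.hasLabel_left), ← hidx q ((hm q).mpr he.hasLabel_right)]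
    exact h₃ _ _ ((hasEdge_skip h p q).mpr he)
  · rintro ⟨h₁, h₂, h₃⟩
    refine ⟨?_, fun q => ?_, fun p q he => ?_⟩
    · rw [List.nodup_append]
      refine ⟨h₁.map (skip_injective i), List.nodup_singleton i, ?_⟩
      rintro a ha b hb rfl
      rw [List.mem_singleton.mp hb] at ha
      exact hi ha
    · by_cases hq : q = i
      · subst hq
        simp [hasLabel_of_mem_qdes h]
      · obtain ⟨q, rfl⟩ := exists_skip_eq hq
        rw [hmem, h₂, hasLabel_skip h]
    · have hp : p ≠ i := by
        rintro rfl
        exact not_hasEdge_of_mem_qdes h q he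
      obtain ⟨p, rfl⟩ := exists_skip_eq hp
      have hpw : p ∈ w := (h₂ p).mpr ((hasLabel_skip h p).mp he.hasLabel_left)
      rw [hidx p hpw]
      by_cases hq : q = i
      · subst hq
        rw [List.idxOf_append_of_notMem hi, List.length_map]
        have := List.idxOf_lt_length_of_mem hpw
        omega
      · obtain ⟨q, rfl⟩ := exists_skip_eq hq
        rw [hidx q ((h₂ q).mpr ((hasLabel_skip h q).mp he.hasLabel_right))]
        exact h₃ _ _ ((hasEdge_skip h p q).mp he)

/-- An internal child of the node labelled `i` would have to occur after the last letter. -/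
theorem IsSylvester.mem_qdes {w : List ℕ} (h : F.IsSylvester (w ++ [i])) : i ∈ F.qdes := by
  obtain ⟨h₁, h₂, h₃⟩ := isSylvester_iff.mp h
  refine mem_qdes_of_not_hasEdge ((h₂ i).mp (by simp)) fun q he => ?_
  have hiw : i ∉ w := fun hi => by
    simpa using (List.nodup_append.mp h₁).2.2 i hi i
  have h₄ := h₃ _ _ he
  have h₅ := List.idxOf_lt_length_of_mem ((h₂ q).mpr he.hasLabel_right)
  rw [List.idxOf_append_of_notMem hiw] at h₄
  simp at h₄ h₅
  omega

/-- The Sylvester words of `F` that end in `i` correspond to those of `F / i`. -/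
theorem isSylvester_append_singleton_iff (h : i ∈ F.qdes) (w : List ℕ) :
    F.IsSylvester (w ++ [i]) ↔ ∃ w', w = w'.map (skip i) ∧ (F.trim i).IsSylvester w' := by
  constructor
  · intro hw
    have hiw : i ∉ w := fun hi => by
      simpa using (List.nodup_append.mp hw.nodup).2.2 i hi i
    obtain ⟨w', rfl⟩ : ∃ w' : List ℕ, w'.map (skip i) = w := by
      have : w ∈ Set.range (List.map (skip i)) := by
        rw [Set.range_list_map]
        intro j hj
        exact exists_skip_eq (ne_of_mem_of_not_mem hj hiw)
      exact this
    exact ⟨w', rfl, (isSylvester_map_skip_append h w').mp hw⟩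
  · rintro ⟨w', rfl, hw⟩
    exact (isSylvester_map_skip_append h w').mpr hw

end IndexedForest

/-! ### Sums over subwords -/

theorem sort_insert_of_lt {s : Finset ℕ} {n : ℕ} (h : ∀ p ∈ s, p < n) :
    (insert n s).sort (· ≤ ·) = s.sort (· ≤ ·) ++ [n] := by
  have hn : n ∉ s.sort (· ≤ ·) := fun hn => (h n ((Finset.mem_sort _).mp hn)).false
  have h₁ : (s.sort (· ≤ ·) ++ [n]).Nodup := by
    rw [List.nodup_append]
    refine ⟨Finset.sort_nodup s _, List.nodup_singleton n, ?_⟩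
    rintro a ha b hb rfl
    exact hn (List.mem_singleton.mp hb ▸ ha)
  have h₂ : (s.sort (· ≤ ·) ++ [n]).toFinset = insert n s := by
    ext x
    simp
  rw [← h₂]
  refine (List.toFinset_sort (· ≤ ·) h₁).mpr ?_
  rw [List.pairwise_append]
  refine ⟨Finset.pairwise_sort s _, List.pairwise_singleton _ _, fun a ha b hb => ?_⟩
  rw [List.mem_singleton.mp hb]
  exact (h a ((Finset.mem_sort _).mp ha)).le

noncomputable section

/-- The factor of position `p` of the word `ω` in the weight of a subword. -/
def letterWeight (ω : List ℕ) (p : ℕ) : PolT :=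
  X (wordPerm (ω.take p) (ω.getD p 0 + 1)) - X (wordPerm (ω.take p) (ω.getD p 0))

open Classical in
/-- The sum of the weights of the subwords of `ω` that satisfy `Φ`. -/
def wordSum (ω : List ℕ) (Φ : List ℕ → Prop) : PolT :=
  ∑ S ∈ (Finset.range ω.length).powerset,
    if Φ ((S.sort (· ≤ ·)).map (ω.getD · 0)) then ∏ p ∈ S, letterWeight ω p else 0

theorem wordSum_nil (Φ : List ℕ → Prop) [Decidable (Φ [])] :
    wordSum [] Φ = if Φ [] then 1 else 0 := by
  simp [wordSum]

theorem wordSum_false (ω : List ℕ) {Φ : List ℕ → Prop} (h : ∀ w, ¬ Φ w) : wordSum ω Φ = 0 := by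
  simp [wordSum, h]

theorem wordPerm_append_singleton (ω : List ℕ) (i : ℕ) :
    wordPerm (ω ++ [i]) = wordPerm ω * simpleTransposition i := by
  simp [wordPerm]

/-- Subwords are split by whether they use the last position. The condition `Φ` is arbitrary because
it changes in the recursion. Positions are natural numbers, so that they survive appending a letter;
the default of `getD` is never read. -/
theorem wordSum_append_singleton (ω : List ℕ) (i : ℕ) (Φ : List ℕ → Prop) :
    wordSum (ω ++ [i]) Φ = wordSum ω Φ +
      (X (wordPerm ω (i + 1)) - X (wordPerm ω i)) * wordSum ω fun w => Φ (w ++ [i]) := by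
  classical
  have hget : ∀ p < ω.length, (ω ++ [i]).getD p 0 = ω.getD p 0 := fun p hp =>
    List.getD_append _ _ _ _ hp
  have hw : ∀ p < ω.length, letterWeight (ω ++ [i]) p = letterWeight ω p := fun p hp => by
    rw [letterWeight, hget p hp, List.take_append_of_le_length hp.le, letterWeight]
  have hlast : (ω ++ [i]).getD ω.length 0 = i := by simp
  have hmap : ∀ S ⊆ Finset.range ω.length, (S.sort (· ≤ ·)).map ((ω ++ [i]).getD · 0) =
      (S.sort (· ≤ ·)).map (ω.getD · 0) := fun S hS => List.map_congr_left fun p hp =>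
    hget p (Finset.mem_range.mp (hS ((Finset.mem_sort _).mp hp)))
  have hprod : ∀ S ⊆ Finset.range ω.length, ∏ p ∈ S, letterWeight (ω ++ [i]) p =
      ∏ p ∈ S, letterWeight ω p := fun S hS => Finset.prod_congr rfl fun p hp =>
    hw p (Finset.mem_range.mp (hS hp))
  rw [wordSum, List.length_append, List.length_singleton, Finset.range_add_one,
    Finset.sum_powerset_insert Finset.notMem_range_self]
  congr 1
  · refine Finset.sum_congr rfl fun S hS => ?_
    rw [Finset.mem_powerset] at hS
    rw [hmap S hS, hprod S hS]
  · rw [wordSum, Finset.mul_sum]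
    refine Finset.sum_congr rfl fun S hS => ?_
    rw [Finset.mem_powerset] at hS
    rw [sort_insert_of_lt fun p hp => Finset.mem_range.mp (hS hp), List.map_append, hmap S hS,
      List.map_singleton, hlast, Finset.prod_insert fun h => Finset.notMem_range_self (hS h),
      hprod S hS, mul_ite, mul_zero, letterWeight, hlast, List.take_left]

theorem sum_sylvesterSubwords (ω : List ℕ) (F : IndexedForest) :
    ∑ S ∈ sylvesterSubwords ω F, subwordWeight ω S = wordSum ω F.IsSylvester := by
  classical
  rw [wordSum, ← Finset.sum_filter, sylvesterSubwords]
  have hw : ∀ S : Finset (Fin ω.length),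
      ((S.map Fin.valEmbedding).sort (· ≤ ·)).map (ω.getD · 0) = subwordAt ω S := fun S => by
    have : (S.sort (· ≤ ·)).map Fin.valEmbedding = (S.map Fin.valEmbedding).sort (· ≤ ·) :=
      Finset.map_sort _ _ _ _ fun _ _ _ _ => Iff.rfl
    rw [← this, List.map_map, subwordAt]
    refine List.map_congr_left fun p _ => ?_
    simp
  refine Finset.sum_nbij (fun S => S.map Fin.valEmbedding) (fun S hS => ?_) ?_ ?_ (fun S _ => ?_)
  · rw [Finset.mem_filter] at hS ⊢
    rw [hw S]
    refine ⟨Finset.mem_powerset.mpr fun x hx => ?_, hS.2⟩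
    obtain ⟨p, _, rfl⟩ := Finset.mem_map.mp hx
    exact Finset.mem_range.mpr p.2
  · exact fun S _ T _ h => Finset.map_injective _ h
  · intro S hS
    rw [Finset.mem_coe, Finset.mem_filter, Finset.mem_powerset] at hS
    have hS' : ∀ p ∈ S, p < ω.length := fun p hp => Finset.mem_range.mp (hS.1 hp)
    have e : (S.attachFin hS').map Fin.valEmbedding = S := by
      ext x
      simp only [Finset.mem_map, Finset.mem_attachFin, Fin.valEmbedding_apply]
      exact ⟨fun ⟨p, hp, h⟩ => h ▸ hp, fun hx => ⟨⟨x, hS' x hx⟩, hx, rfl⟩⟩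
    refine ⟨S.attachFin hS', ?_, e⟩
    rw [Finset.mem_coe, Finset.mem_filter, ← hw, e]
    exact ⟨Finset.mem_univ _, hS.2⟩
  · rw [subwordWeight, Finset.prod_map]
    refine Finset.prod_congr rfl fun p _ => ?_
    simp [letterWeight]

end

/-! ### Admissible words -/

/-- Right multiplication of `σ` by `s_i` removes the non-minimal element `i` from the cycle of
`i + 1`, or adds the fixed point `i` to the cycle of `i + 1` as its new minimum. -/
def IsAdmissibleStep (σ : Equiv.Perm ℕ) (i : ℕ) : Prop :=
  (σ i = i ∧ i < σ (i + 1)) ∨ (σ (i + 1) = i ∧ σ i < i)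

/-- A word all of whose letters are admissible steps from the product of the preceding ones. -/
def IsAdmissibleWord (ω : List ℕ) : Prop :=
  ∀ ω₁ j, ω₁ ++ [j] <+: ω → IsAdmissibleStep (wordPerm ω₁) j

theorem isAdmissibleWord_nil : IsAdmissibleWord [] := fun ω₁ j h => by
  simp at h

theorem isAdmissibleWord_append_singleton {ω : List ℕ} {i : ℕ} :
    IsAdmissibleWord (ω ++ [i]) ↔ IsAdmissibleWord ω ∧ IsAdmissibleStep (wordPerm ω) i := by
  constructor
  · exact fun h =>
      ⟨fun ω₁ j h' => h ω₁ j (h'.trans (List.prefix_append _ _)), h ω i List.prefix_rfl⟩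
  · rintro ⟨h, h'⟩ ω₁ j hp
    rcases List.prefix_concat_iff.mp hp with e | hp
    · obtain ⟨rfl, e'⟩ := List.append_inj' e rfl
      obtain rfl := List.singleton_inj.mp e'
      exact h'
    · exact h ω₁ j hp

/-- `τ` arises from `σ` by deleting the value `i` and its position `p`, which is `i`
or `i + 1`. -/
structure IsDeletion (i p : ℕ) (τ σ : Equiv.Perm ℕ) : Prop where
  pos : p = i ∨ p = i + 1
  apply_pos : σ p = i
  apply_skip : ∀ a, σ (skip p a) = skip i (τ a)

theorem simpleTransposition_left (j : ℕ) : simpleTransposition j j = j + 1 :=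
  Equiv.swap_apply_left _ _

theorem simpleTransposition_right (j : ℕ) : simpleTransposition j (j + 1) = j :=
  Equiv.swap_apply_right _ _

theorem simpleTransposition_of_ne {j a : ℕ} (h₁ : a ≠ j) (h₂ : a ≠ j + 1) :
    simpleTransposition j a = a :=
  Equiv.swap_apply_of_ne_of_ne h₁ h₂

theorem skip_lt_skip {i a b : ℕ} : skip i a < skip i b ↔ a < b := by
  unfold skip
  split_ifs <;> omega

/-- The value `i` returns to the positions `i` and `i + 1` in no admissible step. -/
theorem IsAdmissibleStep.apply_eq_or {σ : Equiv.Perm ℕ} {i j : ℕ} (h : IsAdmissibleStep σ j)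
    (h' : (σ * simpleTransposition j) i = i ∨ (σ * simpleTransposition j) (i + 1) = i) :
    σ i = i ∨ σ (i + 1) = i := by
  have key : ∀ p, p = i ∨ p = i + 1 → (σ * simpleTransposition j) p = i →
      σ i = i ∨ σ (i + 1) = i := by
    intro p hp e
    rw [Equiv.Perm.mul_apply] at e
    by_cases h₁ : p = j
    · subst h₁
      rw [simpleTransposition_left] at e
      rcases hp with rfl | rfl
      · exact .inr e
      · rcases h with ⟨_, h⟩ | ⟨h, _⟩ <;> omega
    · by_cases h₂ : p = j + 1
      · subst h₂
        rw [simpleTransposition_right] at e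
        rcases hp with rfl | hp
        · rcases h with ⟨h, _⟩ | ⟨_, h⟩ <;> omega
        · obtain rfl : j = i := by omega
          exact .inl e
      · rw [simpleTransposition_of_ne h₁ h₂] at e
        rcases hp with rfl | rfl
        · exact .inl e
        · exact .inr e
  rcases h' with h' | h'
  · exact key i (.inl rfl) h'
  · exact key (i + 1) (.inr rfl) h'

namespace IsDeletion

variable {i p : ℕ} {τ σ : Equiv.Perm ℕ}

theorem one (i : ℕ) : IsDeletion i i 1 1 := ⟨.inl rfl, rfl, fun _ => rfl⟩

/-- The letter `i` only moves the deleted value between the positions `i` and `i + 1`, which is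
invisible after deletion. -/
theorem mul_self (h : IsDeletion i p τ σ) :
    IsDeletion i (simpleTransposition i p) τ (σ * simpleTransposition i) := by
  obtain ⟨rfl | rfl, h₁, h₂⟩ := h
  · rw [simpleTransposition_left]
    refine ⟨.inr rfl, ?_, fun a => ?_⟩
    · rw [Equiv.Perm.mul_apply, simpleTransposition_right, h₁]
    · rw [Equiv.Perm.mul_apply, ← h₂ a]
      congr 1
      rcases lt_trichotomy a p with ha | rfl | ha
      · rw [skip, if_pos (by omega), skip, if_pos ha, simpleTransposition_of_ne] <;> omega
      · rw [skip, if_pos (by omega), skip, if_neg (by omega), simpleTransposition_left]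
      · rw [skip, if_neg (by omega), skip, if_neg (by omega), simpleTransposition_of_ne] <;> omega
  · rw [simpleTransposition_right]
    refine ⟨.inl rfl, ?_, fun a => ?_⟩
    · rw [Equiv.Perm.mul_apply, simpleTransposition_left, h₁]
    · rw [Equiv.Perm.mul_apply, ← h₂ a]
      congr 1
      rcases lt_trichotomy a i with ha | rfl | ha
      · rw [skip, if_pos (by omega), skip, if_pos (by omega), simpleTransposition_of_ne] <;> omega
      · rw [skip, if_neg (by omega), skip, if_pos (by omega), simpleTransposition_right]
      · rw [skip, if_neg (by omega), skip, if_neg (by omega), simpleTransposition_of_ne] <;> omega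

/-- A letter other than `i` that moved the value `i` would carry it out of the positions `i`, `i +
1`. So the swapped positions avoid `p`, and there `skip p` and `skip i` agree. -/
theorem skip_pos (h : IsDeletion i p τ σ) {j : ℕ}
    (h' : (σ * simpleTransposition (skip i j)) i = i ∨
      (σ * simpleTransposition (skip i j)) (i + 1) = i) :
    skip p j = skip i j ∧ skip p (j + 1) = skip i j + 1 := by
  have hne := skip_ne i j
  have h₀ := h.pos
  have key : ∀ q, (σ * simpleTransposition (skip i j)) q = i → q = i ∨ q = i + 1 := by
    intro q hq
    rcases h' with h' | h'
    · exact .inl ((σ * simpleTransposition (skip i j)).injective (hq.trans h'.symm))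
    · exact .inr ((σ * simpleTransposition (skip i j)).injective (hq.trans h'.symm))
  have h₁ : p ≠ skip i j := by
    intro hp
    have := key (p + 1) (by
      rw [Equiv.Perm.mul_apply, hp, simpleTransposition_right, ← hp, h.apply_pos])
    omega
  have h₂ : p ≠ skip i j + 1 := by
    intro hp
    have := key (skip i j) (by
      rw [Equiv.Perm.mul_apply, simpleTransposition_left, ← hp, h.apply_pos])
    omega
  unfold skip at *
  split_ifs at * <;> omega

theorem mul_skip (h : IsDeletion i p τ σ) {j : ℕ}
    (h' : (σ * simpleTransposition (skip i j)) i = i ∨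
      (σ * simpleTransposition (skip i j)) (i + 1) = i) :
    IsDeletion i p (τ * simpleTransposition j) (σ * simpleTransposition (skip i j)) := by
  obtain ⟨e₁, e₂⟩ := h.skip_pos h'
  refine ⟨h.pos, ?_, fun a => ?_⟩
  · rw [Equiv.Perm.mul_apply, simpleTransposition_of_ne, h.apply_pos]
    · rw [← e₁]; exact (skip_ne p j).symm
    · rw [← e₂]; exact (skip_ne p (j + 1)).symm
  · rw [Equiv.Perm.mul_apply, Equiv.Perm.mul_apply, ← h.apply_skip]
    congr 1
    by_cases h₁ : a = j
    · rw [h₁, e₁, simpleTransposition_left, simpleTransposition_left, e₂]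
    · by_cases h₂ : a = j + 1
      · rw [h₂, e₂, simpleTransposition_right, simpleTransposition_right, e₁]
      · rw [simpleTransposition_of_ne h₁ h₂, simpleTransposition_of_ne]
        · rw [← e₁]; exact (skip_injective p).ne h₁
        · rw [← e₂]; exact (skip_injective p).ne h₂

theorem isAdmissibleStep (h : IsDeletion i p τ σ) {j : ℕ}
    (h' : (σ * simpleTransposition (skip i j)) i = i ∨
      (σ * simpleTransposition (skip i j)) (i + 1) = i)
    (hs : IsAdmissibleStep σ (skip i j)) : IsAdmissibleStep τ j := by
  obtain ⟨e₁, e₂⟩ := h.skip_pos h'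
  unfold IsAdmissibleStep at *
  rwa [← e₂, ← e₁, h.apply_skip, h.apply_skip, e₁, skip_lt_skip, skip_lt_skip,
    (skip_injective i).eq_iff, (skip_injective i).eq_iff] at hs

end IsDeletion

/-- Delete all occurrences of the letter `i` and lower the larger letters by one. -/
def deleteLetter (i : ℕ) (ω : List ℕ) : List ℕ :=
  (ω.filter (· ≠ i)).map fun j => if j < i then j else j - 1

theorem deleteLetter_append_self (i : ℕ) (ω : List ℕ) :
    deleteLetter i (ω ++ [i]) = deleteLetter i ω := by
  simp [deleteLetter]

theorem deleteLetter_append_skip (i j : ℕ) (ω : List ℕ) :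
    deleteLetter i (ω ++ [skip i j]) = deleteLetter i ω ++ [j] := by
  have : (if skip i j < i then skip i j else skip i j - 1) = j := by
    unfold skip
    split_ifs <;> omega
  rw [deleteLetter, List.filter_append, List.filter_singleton]
  simp [skip_ne, this, deleteLetter]

theorem length_deleteLetter_le (i : ℕ) (ω : List ℕ) : (deleteLetter i ω).length ≤ ω.length := by
  rw [deleteLetter, List.length_map]
  exact List.length_filter_le _ _

/-- By `IsAdmissibleStep.apply_eq_or` the hypothesis on the position of `i` passes back to every
prefix. Each letter `i` then leaves the deleted permutation unchanged, and every other letter acts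
on it as its lowered version, with matching weight. -/
theorem IsAdmissibleWord.exists_isDeletion {ω : List ℕ} {i : ℕ} (hω : IsAdmissibleWord ω)
    (hi : wordPerm ω i = i ∨ wordPerm ω (i + 1) = i) :
    (∃ p, IsDeletion i p (wordPerm (deleteLetter i ω)) (wordPerm ω)) ∧
      IsAdmissibleWord (deleteLetter i ω) ∧ ∀ Φ : List ℕ → Prop,
        wordSum ω (fun w => ∃ w', w = w'.map (skip i) ∧ Φ w') =
          rename (skip i) (wordSum (deleteLetter i ω) Φ) := by
  classical
  induction ω using List.reverseRecOn with
  | nil =>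
    refine ⟨⟨i, IsDeletion.one i⟩, isAdmissibleWord_nil, fun Φ => ?_⟩
    have : deleteLetter i [] = [] := rfl
    rw [this, wordSum_nil, wordSum_nil]
    have : (∃ w' : List ℕ, [] = w'.map (skip i) ∧ Φ w') ↔ Φ [] :=
      ⟨fun ⟨w', h, hw⟩ => by rwa [List.map_eq_nil_iff.mp h.symm] at hw, fun h => ⟨[], rfl, h⟩⟩
    simp only [this]
    split_ifs <;> simp
  | append_singleton ω j ih =>
    rw [isAdmissibleWord_append_singleton] at hω
    rw [wordPerm_append_singleton] at hi
    obtain ⟨⟨p, hp⟩, had, hsum⟩ := ih hω.1 (hω.2.apply_eq_or hi)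
    by_cases hj : j = i
    · subst hj
      rw [deleteLetter_append_self, wordPerm_append_singleton]
      refine ⟨⟨_, hp.mul_self⟩, had, fun Φ => ?_⟩
      rw [wordSum_append_singleton, hsum, add_eq_left]
      -- A word in the image of `skip j` cannot end in `j`, so no subword counted uses this
      -- position.
      refine mul_eq_zero_of_right _ (wordSum_false ω ?_)
      rintro w ⟨w', h, -⟩
      have : j ∈ w'.map (skip j) := h ▸ by simp
      obtain ⟨a, -, ha⟩ := List.mem_map.mp this
      exact skip_ne j a ha
    · obtain ⟨j, rfl⟩ := exists_skip_eq hj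
      rw [deleteLetter_append_skip, wordPerm_append_singleton, wordPerm_append_singleton]
      refine ⟨⟨p, hp.mul_skip hi⟩,
        isAdmissibleWord_append_singleton.mpr ⟨had, hp.isAdmissibleStep hi hω.2⟩, fun Φ => ?_⟩
      obtain ⟨e₁, e₂⟩ := hp.skip_pos hi
      rw [wordSum_append_singleton, wordSum_append_singleton, hsum,
        map_add (rename (skip i) : PolT →ₐ[ℤ] PolT), map_mul, map_sub,
        rename_X, rename_X, ← hp.apply_skip, ← hp.apply_skip, e₁, e₂]
      congr 2
      rw [← hsum]
      congr 1
      funext w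
      refine propext ⟨?_, ?_⟩
      · rintro ⟨w', h, hw⟩
        obtain ⟨u, v, rfl, rfl, hv⟩ := List.map_eq_append_iff.mp h.symm
        obtain ⟨a, rfl, ha⟩ := List.map_eq_singleton_iff.mp hv
        obtain rfl := skip_injective i ha
        exact ⟨u, rfl, hw⟩
      · rintro ⟨w', rfl, hw⟩
        exact ⟨w' ++ [j], by simp, hw⟩

/-! ### Evaluations -/

noncomputable section

/-- `f ↦ f(t_{s(τ(0))}, t_{s(τ(1))}, …; t)`, where `s` is the increasing map that omits `i`. -/
def evSkip (i : ℕ) (τ : Equiv.Perm ℕ) : PolTX →ₐ[ℤ] PolT :=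
  aeval (Sum.elim (fun a => X (skip i (τ a))) X)

theorem evSkip_xVar (i : ℕ) (τ : Equiv.Perm ℕ) (j : ℕ) :
    evSkip i τ (xVar j) = X (skip i (τ j)) := by
  simp [evSkip, xVar]

theorem evSkip_tVar (i : ℕ) (τ : Equiv.Perm ℕ) (j : ℕ) : evSkip i τ (tVar j) = X j := by
  simp [evSkip, tVar]

theorem evPerm_xVar (σ : Equiv.Perm ℕ) (j : ℕ) : evPerm σ (xVar j) = X (σ j) := by
  simp [evPerm, xVar]

theorem evPerm_tVar (σ : Equiv.Perm ℕ) (j : ℕ) : evPerm σ (tVar j) = X j := by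
  simp [evPerm, tVar]

theorem evSkip_omitT (i : ℕ) (τ : Equiv.Perm ℕ) (f : PolTX) :
    evSkip i τ (omitT i f) = rename (skip i) (evPerm τ f) := by
  have := polTX_hom_ext (φ := (evSkip i τ).comp (omitT i))
    (ψ := (rename (skip i)).comp (evPerm τ))
    (fun j => by simp [evSkip_xVar, evPerm_xVar])
    (fun j => by simp [evSkip_tVar, evPerm_tVar, omitT_tVar]) f
  simpa only [AlgHom.comp_apply] using this

theorem IsDeletion.evPerm_eq {i p : ℕ} {τ σ : Equiv.Perm ℕ} (h : IsDeletion i p τ σ) (f : PolTX) :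
    evPerm σ f = evSkip i τ (insertT p i f) := by
  have := polTX_hom_ext (φ := evPerm σ) (ψ := (evSkip i τ).comp (insertT p i))
    (fun j => by
      rw [AlgHom.comp_apply, insertT_xVar, evPerm_xVar]
      split_ifs with h₁ h₂
      · rw [evSkip_xVar, ← h.apply_skip, skip, if_pos h₁]
      · rw [evSkip_tVar, h₂, h.apply_pos]
      · rw [evSkip_xVar, ← h.apply_skip, skip, if_neg (by omega), Nat.sub_add_cancel (by omega)])
    (fun j => by simp [evSkip_tVar, evPerm_tVar]) f
  simpa only [AlgHom.comp_apply] using this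

/-- Both evaluations factor through `evSkip i τ`, after inserting `t_i` at `i` or at `i + 1`;
`mul_trimAt` compares the two insertions. If `p = i + 1` they exchange roles, and so do `σ i` and `σ
(i + 1)`, so the sign is the same. -/
theorem IsDeletion.evPerm_mul {i p : ℕ} {τ σ : Equiv.Perm ℕ} (h : IsDeletion i p τ σ)
    (f : PolTX) : evPerm (σ * simpleTransposition i) f =
      evPerm σ f + (X (σ (i + 1)) - X (σ i)) * evSkip i τ (eqTrim i f) := by
  have e := congrArg (evSkip i τ) (mul_trimAt i i f)
  rw [map_mul, map_sub, map_sub, evSkip_xVar, evSkip_tVar] at e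
  rw [h.mul_self.evPerm_eq, h.evPerm_eq, eqTrim_eq_trimAt]
  have h₂ := h.apply_skip i
  have h₁ := h.apply_pos
  rcases h.pos with rfl | rfl
  · rw [simpleTransposition_left, h₁]
    rw [skip, if_neg (by omega)] at h₂
    rw [h₂, e]
    ring
  · rw [simpleTransposition_right, h₁]
    rw [skip, if_pos (by omega)] at h₂
    rw [h₂, ← neg_sub, neg_mul, e]
    ring

theorem IsDoubleForestFamily.evPerm_eq_wordSum {P : IndexedForest → PolTX}
    (hP : IsDoubleForestFamily P) {ω : List ℕ} (hω : IsAdmissibleWord ω) (F : IndexedForest) :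
    evPerm (wordPerm ω) (P F) = wordSum ω F.IsSylvester := by
  classical
  induction hn : ω.length using Nat.strong_induction_on generalizing ω F with
  | _ n ih =>
    rcases List.eq_nil_or_concat ω with rfl | ⟨ω, i, rfl⟩
    · rw [wordSum_nil]
      simp only [IndexedForest.isSylvester_nil_iff]
      exact (hP.normalized F).trans (by congr)
    · rw [List.concat_eq_append] at *
      rw [isAdmissibleWord_append_singleton] at hω
      have hlen : ω.length < n := by rw [← hn]; simp
      have hi : wordPerm ω i = i ∨ wordPerm ω (i + 1) = i :=
        hω.2.imp And.left And.left
      obtain ⟨⟨p, hp⟩, had, hsum⟩ := hω.1.exists_isDeletion hi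
      rw [wordPerm_append_singleton, hp.evPerm_mul, wordSum_append_singleton,
        ih _ hlen hω.1 F rfl, hP.trimming]
      -- What remains is the evaluation of the trimmed polynomial against the sum over Sylvester
      -- subwords that are completed by `i`.
      congr 2
      by_cases hq : i ∈ F.qdes
      · rw [if_pos hq, evSkip_omitT,
          ih _ ((length_deleteLetter_le i ω).trans_lt hlen) had (F.trim i) rfl, ← hsum]
        simp only [IndexedForest.isSylvester_append_singleton_iff hq]
      · rw [if_neg hq, map_zero, wordSum_false]
        exact fun w hw => hq hw.mem_qdes

end

/-! ### Noncrossing reduced words are admissible -/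

/-- All that matters about the cycle is order: an element goes to the next smaller one in its block,
and the minimum goes to the maximum. -/
theorem backwardCycle_spec {B : Finset ℕ} {a : ℕ} (ha : a ∈ B) :
    backwardCycle B a ∈ B ∧
      ((backwardCycle B a < a ∧ ∀ c ∈ B, c < a → c ≤ backwardCycle B a) ∨
        ∀ c ∈ B, a ≤ c ∧ c ≤ backwardCycle B a) := by
  have hs := Finset.sortedGT_sort B
  have hmem : ∀ c, c ∈ B.sort (· ≥ ·) ↔ c ∈ B := fun c => Finset.mem_sort _
  rw [backwardCycle]
  generalize B.sort (· ≥ ·) = l at hs hmem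
  obtain ⟨k, hk, rfl⟩ := List.getElem_of_mem ((hmem a).mpr ha)
  rw [List.formPerm_apply_getElem _ hs.nodup]
  refine ⟨(hmem _).mp (List.getElem_mem _), ?_⟩
  rcases Nat.lt_or_ge (k + 1) l.length with h | h
  · simp only [Nat.mod_eq_of_lt h]
    refine .inl ⟨hs.getElem_lt_getElem_iff.mpr (by omega), fun c hc hca => ?_⟩
    obtain ⟨m, hm, rfl⟩ := List.getElem_of_mem ((hmem c).mpr hc)
    rw [hs.getElem_lt_getElem_iff] at hca
    rw [hs.getElem_le_getElem_iff]
    omega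
  · obtain h : k + 1 = l.length := by omega
    simp only [h, Nat.mod_self]
    refine .inr fun c hc => ?_
    obtain ⟨m, hm, rfl⟩ := List.getElem_of_mem ((hmem c).mpr hc)
    rw [hs.getElem_le_getElem_iff, hs.getElem_le_getElem_iff]
    omega

/-- The block structure of a noncrossing permutation. -/
theorem IsNoncrossingPerm.exists_blocks {n : ℕ} {σ : Equiv.Perm ℕ} (h : IsNoncrossingPerm n σ) :
    ∃ P : Finpartition (Finset.range n), IsNoncrossingPartition P ∧
      ∀ B ∈ P.parts, ∀ a ∈ B, σ a ∈ B ∧ ((σ a < a ∧ ∀ c ∈ B, c < a → c ≤ σ a) ∨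
        ∀ c ∈ B, a ≤ c ∧ c ≤ σ a) := by
  obtain ⟨-, P, hP, hσ⟩ := h
  exact ⟨P, hP, fun B hB a ha => hσ B hB a ha ▸ backwardCycle_spec ha⟩

theorem isAdmissibleStep_of_isNoncrossingPerm {n i : ℕ} {σ : Equiv.Perm ℕ} (hi : i + 1 < n)
    (hσ : IsNoncrossingPerm n σ) (hσ' : IsNoncrossingPerm n (σ * simpleTransposition i))
    (hlt : σ i < σ (i + 1)) : IsAdmissibleStep σ i := by
  by_contra hna
  simp only [IsAdmissibleStep, not_or, not_and] at hna
  have h₁ : σ i ≠ i := fun h => hna.1 h (by omega)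
  have h₂ : σ (i + 1) ≠ i := fun h => hna.2 h (by omega)
  have e₁ : (σ * simpleTransposition i) i = σ (i + 1) := by
    rw [Equiv.Perm.mul_apply, simpleTransposition_left]
  have e₂ : (σ * simpleTransposition i) (i + 1) = σ i := by
    rw [Equiv.Perm.mul_apply, simpleTransposition_right]
  obtain ⟨P, hP, hb⟩ := hσ.exists_blocks
  obtain ⟨P', hP', hb'⟩ := hσ'.exists_blocks
  obtain ⟨A, hA, hiA⟩ := P.exists_mem (Finset.mem_range.mpr (by omega : i < n))
  obtain ⟨B, hB, hiB⟩ := P.exists_mem (Finset.mem_range.mpr hi)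
  obtain ⟨A', hA', hiA'⟩ := P'.exists_mem (Finset.mem_range.mpr (by omega : i < n))
  obtain ⟨B', hB', hiB'⟩ := P'.exists_mem (Finset.mem_range.mpr hi)
  obtain ⟨hA₁, hA₂⟩ := hb A hA i hiA
  obtain ⟨hB₁, hB₂⟩ := hb B hB (i + 1) hiB
  obtain ⟨hA'₁, hA'₂⟩ := hb' A' hA' i hiA'
  obtain ⟨hB'₁, hB'₂⟩ := hb' B' hB' (i + 1) hiB'
  rw [e₁] at hA'₁ hA'₂
  rw [e₂] at hB'₁ hB'₂
  -- In a common block `i` would be the next element below `i + 1`, forcing `σ (i + 1) = i`. The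
  -- same argument for `σ * simpleTransposition i` would force `σ i = i`.
  have hAB : A ≠ B := by
    rintro rfl
    rcases hB₂ with ⟨h, h'⟩ | h
    · have := h' i hiA (by omega); omega
    · have := h i hiA; omega
  have hAB' : A' ≠ B' := by
    rintro rfl
    rcases hB'₂ with ⟨h, h'⟩ | h
    · have := h' i hiA' (by omega); omega
    · have := h i hiA'; omega
  -- Three crossings remain: `σ i < σ (i + 1) < i < i + 1` in `P`, `σ i < i < i + 1 < σ (i + 1)` in
  -- `P'`, and `i < i + 1 < σ i < σ (i + 1)` in `P`.
  rcases hA₂ with ⟨hA₂, -⟩ | hA₂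
  · rcases hB₂ with ⟨hB₂, -⟩ | hB₂
    · exact hP A hA B hB hAB _ hA₁ _ hiA _ hB₁ _ hiB (by omega)
    · have h₃ := hB₂ (i + 1) hiB
      have h₄ : σ (i + 1) ≠ i + 1 := by
        intro h
        rw [h] at hA'₁
        exact hAB' (P'.eq_of_mem_parts hA' hB' hA'₁ hiB')
      exact hP' B' hB' A' hA' hAB'.symm _ hB'₁ _ hiB' _ hiA' _ hA'₁ (by omega)
  · have h₃ := hA₂ i hiA
    have h₄ : σ i ≠ i + 1 := fun h => hAB (P.eq_of_mem_parts hA hB (h ▸ hA₁) hiB)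
    exact hP A hA B hB hAB _ hiA _ hA₁ _ hiB _ hB₁ (by omega)

/-- If `σ i > σ (i + 1)`, then `(i, i + 1)` is no inversion of the product, and exchanging the
positions `i` and `i + 1` maps its inversions injectively to those of `σ`. -/
theorem lt_of_permLength_lt {n i : ℕ} {σ : Equiv.Perm ℕ} (hi : i + 1 < n)
    (h : permLength n σ < permLength n (σ * simpleTransposition i)) : σ i < σ (i + 1) := by
  by_contra hlt
  refine absurd h (not_lt.mpr ?_)
  refine Finset.card_le_card_of_injOn
    (fun p => (simpleTransposition i p.1, simpleTransposition i p.2)) ?_ ?_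
  · rintro ⟨a, b⟩ hab
    replace hab := Finset.mem_filter.mp hab
    refine Finset.mem_filter.mpr ?_
    simp only [Finset.mem_product, Finset.mem_range, Equiv.Perm.mul_apply] at hab ⊢
    have hran : ∀ c, c < n → simpleTransposition i c < n := by
      intro c hc
      by_cases h₁ : c = i
      · rw [h₁, simpleTransposition_left]; exact hi
      · by_cases h₂ : c = i + 1
        · rw [h₂, simpleTransposition_right]; omega
        · rwa [simpleTransposition_of_ne h₁ h₂]
    refine ⟨⟨hran a hab.1.1, hran b hab.1.2⟩, ?_, hab.2.2⟩
    obtain ⟨-, hab, hσ⟩ := hab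
    by_cases ha : a = i
    · subst ha
      rw [simpleTransposition_left] at hσ ⊢
      by_cases hb : b = a + 1
      · subst hb
        rw [simpleTransposition_right] at hσ
        omega
      · rw [simpleTransposition_of_ne (by omega) hb]
        omega
    · by_cases ha' : a = i + 1
      · subst ha'
        rw [simpleTransposition_right, simpleTransposition_of_ne (by omega) (by omega)]
        omega
      · rw [simpleTransposition_of_ne ha ha']
        by_cases hb : b = i
        · rw [hb, simpleTransposition_left]; omega
        · by_cases hb' : b = i + 1
          · rw [hb', simpleTransposition_right]; omega
          · rwa [simpleTransposition_of_ne hb hb']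
  · rintro ⟨a, b⟩ - ⟨c, d⟩ - h
    simpa using h

theorem simpleTransposition_mul_self (i : ℕ) :
    simpleTransposition i * simpleTransposition i = 1 :=
  Equiv.swap_mul_self _ _

theorem IsNoncrossingReducedWord.isAdmissibleWord {n : ℕ} {σ : Equiv.Perm ℕ} {ω : List ℕ}
    (h : IsNoncrossingReducedWord n σ ω) : IsAdmissibleWord ω := by
  rintro ω₁ j ⟨ω₂, rfl⟩
  have hk : ω₁.length < (ω₁ ++ [j] ++ ω₂).length := by simp
  obtain ⟨h₁, h₂, h₃, h₄⟩ := h.2 ⟨ω₁.length, hk⟩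
  have e₁ : (ω₁ ++ [j] ++ ω₂).take (ω₁.length + 1) = ω₁ ++ [j] :=
    List.take_left' (by simp)
  have e₂ : (ω₁ ++ [j] ++ ω₂).get ⟨ω₁.length, hk⟩ = j := by simp
  -- Removing the descent `j` cancels the last letter and gives back `wordPerm ω₁`, so both ends of
  -- the step are noncrossing.
  simp only [e₁, e₂, wordPerm_append_singleton, mul_assoc, simpleTransposition_mul_self,
    mul_one] at h₁ h₂ h₃ h₄
  exact isAdmissibleStep_of_isNoncrossingPerm h₂ h₃ h₁ (lt_of_permLength_lt h₂ h₄)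

theorem theorem8p2 (n : ℕ) (F : IndexedForest) (hF : F.support ⊆ Set.Iio n)
    (σ : Equiv.Perm ℕ) (hσ : IsNoncrossingPerm n σ)
    (ω : List ℕ) (hω : IsNoncrossingReducedWord n σ ω) :
    evPerm σ (doubleForestPoly F) = ∑ S ∈ sylvesterSubwords ω F, subwordWeight ω S := by
  rw [sum_sylvesterSubwords, ← hω.1]
  exact isDoubleForestFamily_doubleForestPoly.evPerm_eq_wordSum hω.isAdmissibleWord F
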